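/- **Theorem 1.** Let $H$ be a finite connected graph (multiple edges allowed, no loops) with vertices $v_1,\dots,v_m$; let $a_{i,j}$ be the number of edges between $v_i$ and $v_j$, and let $d_i=\sum_j a_{i,j}$. Let $n\ge 1$, and for each $i$ let $1\le s_{i,1}<\dots<s_{i,k_i}\le n/2$ be integers. Let $G_i=C_n(s_{i,1},\dots,s_{i,k_i})$ be the circulant multigraph on $\mathbb{Z}/n$ that has, for every $k\in\mathbb{Z}/n$ and every $j$, one edge joining $k$ and $k+s_{i,j}$ (so the jump $n/2$ gives double edges); if $k_i=0$, then $G_i$ has no edges. The circulant foliation $H_n=H_n(G_1,\dots,G_m)$ is the multigraph with vertices $(k,v_i)$, $k\in\mathbb{Z}/n$, $1\le i\le m$, in which $(k,v_i)$ and $(k,v_j)$ are joined by $a_{i,j}$ edges for each $k$ and all $i\neq j$, and in which for each $i$ the vertices $(k,v_i)$, $k\in\mathbb{Z}/n$, form a copy of $G_i$. Let $\tau(n)$ and $\tau(H)$ be the numbers of spanning trees of $H_n$ and of $H$. Let $T_k$ be the Chebyshev polynomial of the first kind, let $A(H)=(a_{i,j})$, and put $$Q(w)=\det\bigl(\operatorname{diag}(w_1,\dots,w_m)-A(H)\bigr),\qquad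 w_i=2k_i+d_i-\sum_{j=1}^{k_i}2T_{s_{i,j}}(w).$$ Put $s=\sum_i s_{i,k_i}$ (a term with $k_i=0$ counts as $0$) and $q=\sum_{i=1}^m\sum_{j=1}^{k_i}s_{i,j}^2$. 1. If $k_i\ge1$ for all $i$, then $Q$ has, counted with multiplicity, exactly $s-1$ complex roots $w_1,\dots,w_{s-1}$ different from $1$, and $$\tau(n)=\frac{n}{q}\prod_{p=1}^{s-1}|2T_n(w_p)-2|.$$ 2. More generally, if $k_i\ge 1$ for at least one $i$, then $Q$ again has exactly $s-1$ complex roots $w_1,\dots,w_{s-1}$ different from $1$, counted with multiplicity, and $$\tau(n)=\frac{n\,\eta^{n}}{q}\prod_{p=1}^{s-1}|2T_n(w_p)-2|,$$ where $\eta$ is the principal minor of the Laplacian matrix of $H$ on the rows and columns $i$ with $k_i=0$ ($\eta=1$ if there are none). 3. In all cases $\tau(n)$ is a multiple of $n\,\tau(H)$. -/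

import Mathlib

/-!
Multigraphs are Mathlib's `Graph α β`: vertices in `α`, named edges in `β`, parallel edges allowed.
-/

namespace CirculantFoliation

/-! ### Connectedness, cycles, spanning trees of multigraphs -/

section Trees

variable {α β : Type*}

/-- A multigraph is connected if it has a vertex and any two vertices are joined by a walk. -/
def IsConnected (G : Graph α β) : Prop :=
  G.vertexSet.Nonempty ∧
    ∀ x ∈ G.vertexSet, ∀ y ∈ G.vertexSet, Relation.ReflTransGen G.Adj x y

/-- A multigraph has a cycle if for some `k ≥ 1` there are `k` distinct vertices
`v 0, …, v (k-1)`, with `v k = v 0`, and `k` distinct edges `e 0, …, e (k-1)` such that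
`e i` joins `v i` and `v (i+1)`. A loop is a cycle with `k = 1`, a pair of parallel edges
is a cycle with `k = 2`. -/
def HasCycle (G : Graph α β) : Prop :=
  ∃ (k : ℕ) (v : ℕ → α) (e : ℕ → β), 1 ≤ k ∧ v k = v 0 ∧
    Set.InjOn v (Set.Iio k) ∧ Set.InjOn e (Set.Iio k) ∧
    ∀ i < k, G.IsLink (e i) (v i) (v (i + 1))

/-- A tree is a connected multigraph without cycles. -/
def IsTree (G : Graph α β) : Prop :=
  IsConnected G ∧ ¬ HasCycle G

/-- The number `τ(G)` of spanning trees of `G`: subgraphs of `G` containing all vertices of `G`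
that are trees. -/
noncomputable def numSpanningTrees (G : Graph α β) : ℕ :=
  {T : Graph α β | T.IsSpanningSubgraph G ∧ IsTree T}.ncard

end Trees

/-! ### Circulant graphs and circulant foliations -/

section Foliation

/-- The circulant graph `C_n(s_1, …, s_k)` with set of jumps `S = {s_1, …, s_k}`, as a multigraph
on `ZMod n`. For every vertex `k` and every jump `a ∈ S` there is one edge, named `(k, a)`,
joining `k` and `k + a`. So, if `n` is even, the jump `n / 2` produces two edges
between `k` and `k + n / 2`. For `S = ∅` there are no edges. -/
def circulant (n : ℕ) (S : Finset ℕ) : Graph (ZMod n) (ZMod n × ℕ) where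
  vertexSet := Set.univ
  IsLink e x y := e.2 ∈ S ∧ s(x, y) = s(e.1, e.1 + (e.2 : ZMod n))
  isLink_symm := fun _ _ => ⟨fun _ _ h => ⟨h.1, Sym2.eq_swap.trans h.2⟩⟩
  eq_or_eq_of_isLink_of_isLink := by
    rintro e x y v w ⟨-, h1⟩ ⟨-, h2⟩
    have h := h1.trans h2.symm
    rcases Sym2.eq_iff.mp h with h | h
    · exact Or.inl h.1
    · exact Or.inr h.1
  left_mem_of_isLink := fun _ _ _ _ => Set.mem_univ _

variable {α β : Type*}

/-- The circulant foliation `H_n(G_1, …, G_m)` over `H`, where the fibre over the vertex `i` is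
the circulant graph on `n` vertices with set of jumps `s i`. The edge named `Sum.inl (k, e)` is the
`k`-th copy of the edge `e` of `H`; the edge named `Sum.inr (i, f)` is the edge `f` of the fibre
over the vertex `i`. -/
def foliation (n : ℕ) (H : Graph α β) (s : α → Finset ℕ) :
    Graph (ZMod n × α) ((ZMod n × β) ⊕ (α × (ZMod n × ℕ))) where
  vertexSet := {x | x.2 ∈ H.vertexSet}
  IsLink ε x y :=
    match ε with
    | Sum.inl (k, e) => x.1 = k ∧ y.1 = k ∧ H.IsLink e x.2 y.2
    | Sum.inr (i, f) => i ∈ H.vertexSet ∧ x.2 = i ∧ y.2 = i ∧ (circulant n (s i)).IsLink f x.1 y.1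
  isLink_symm := by
    rintro (⟨k, e⟩ | ⟨i, f⟩) -
    · exact ⟨fun _ _ h => ⟨h.2.1, h.1, h.2.2.symm⟩⟩
    · exact ⟨fun _ _ h => ⟨h.1, h.2.2.1, h.2.1, h.2.2.2.symm⟩⟩
  eq_or_eq_of_isLink_of_isLink := by
    rintro (⟨k, e⟩ | ⟨i, f⟩) ⟨x1, x2⟩ ⟨y1, y2⟩ ⟨v1, v2⟩ ⟨w1, w2⟩ h h'
    · obtain ⟨h1, h2, h3⟩ := h
      obtain ⟨h1', h2', h3'⟩ := h'
      simp only at h1 h2 h1' h2' h3 h3'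
      subst h1 h2 h1'
      subst h2'
      rcases h3.left_eq_or_eq h3' with h | h
      · exact Or.inl (Prod.ext rfl h)
      · exact Or.inr (Prod.ext rfl h)
    · obtain ⟨-, h1, h2, h3⟩ := h
      obtain ⟨-, h1', h2', h3'⟩ := h'
      simp only at h1 h2 h1' h2' h3 h3'
      subst h1 h1' h2'
      rcases h3.left_eq_or_eq h3' with h | h
      · exact Or.inl (Prod.ext h rfl)
      · exact Or.inr (Prod.ext h rfl)
  left_mem_of_isLink := by
    rintro (⟨k, e⟩ | ⟨i, f⟩) x y h
    · exact h.2.2.left_mem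
    · exact (show x.2 ∈ H.vertexSet by rw [h.2.1]; exact h.1)

end Foliation

/-! ### Laplacians and the Chebyshev transform -/

section Laplacian

variable {α β : Type*}

/-- The number `a_{uv}` of edges between the vertices `u` and `v`. -/
noncomputable def numEdges (G : Graph α β) (u v : α) : ℕ :=
  {e : β | G.IsLink e u v}.ncard

variable [Fintype α]

/-- The degree `d_v = ∑_u a_{uv}` of a vertex of a loopless multigraph. -/
noncomputable def degree (G : Graph α β) (v : α) : ℕ :=
  ∑ u, numEdges G u v

variable [DecidableEq α]

/-- The generalized Laplacian `L(G, X) = diag(X) - A(G)`, where `A(G) = (a_{uv})`. -/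
noncomputable def genLaplacian {R : Type*} [CommRing R] (G : Graph α β) (X : α → R) :
    Matrix α α R :=
  Matrix.diagonal X - Matrix.of fun u v => (numEdges G u v : R)

/-- The Laplacian `L(G) = D(G) - A(G)`. -/
noncomputable def laplacian (G : Graph α β) : Matrix α α ℤ :=
  genLaplacian G fun v => (degree G v : ℤ)

/-- The Chebyshev transform `Q(w) = det L(H, W)`, where
`W_i = 2 k_i + d_i - ∑_{a ∈ s i} 2 T_a(w)` and `k_i` is the number of jumps in `s i`. -/
noncomputable def chebyshevTransform (H : Graph α β) (s : α → Finset ℕ) : Polynomial ℤ :=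
  (genLaplacian H fun i =>
    (2 * ((s i).card : Polynomial ℤ) + (degree H i : Polynomial ℤ)
      - ∑ a ∈ s i, 2 * Polynomial.Chebyshev.T ℤ (a : ℤ))).det

/-- The complex roots of `Q` different from `1`, with multiplicity. -/
noncomputable def rootsNeOne (H : Graph α β) (s : α → Finset ℕ) : Multiset ℂ :=
  ((chebyshevTransform H s).aroots ℂ).filter (· ≠ 1)

/-- The principal minor `η` of the Laplacian of `H` on the set of vertices with empty fibre.
If there are no such vertices, this is the determinant of the empty matrix, namely `1`. -/
noncomputable def emptyFibreMinor (H : Graph α β) (s : α → Finset ℕ) : ℤ :=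
  ((laplacian H).submatrix (fun i : {i // s i = ∅} => i.1) (fun i : {i // s i = ∅} => i.1)).det

end Laplacian

end CirculantFoliation

/-! Write L and L_n for the Laplacians of H and H_n, m for the number of vertices of H, and J for an
all-ones matrix. The matrix-tree theorem, proved here from Cauchy–Binet and the unimodularity of
incidence matrices, gives det(L_n + J) = (nm)² τ(n). The cyclic group acts on H_n, so the characters
of ℤ/n block-diagonalize L_n + J. The block at j ≠ 0 is L plus the diagonal matrix of the circulant
eigenvalues at j. The block at 0 is L + nJ, with determinant n m² τ(H). Hence n τ(n) = τ(H) times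
the product of the blocks' determinants over j ≠ 0 (`IsEdgeEnumeration.numSpanningTrees_foliation`).

Put t_j = ζ^j + ζ^(-j) with ζ a primitive n-th root of unity, and P(2w) = Q(w). Since C_a(z + 1/z) =
z^a + z^(-a) for the rescaled Chebyshev polynomials C_a, the block at j has determinant P(t_j). As L
is singular, P(2) = 0, so P = (2 - X) R over ℤ, and differentiation gives R(2) = q τ(H). The product
of 2 - t_j over j ≠ 0 is n², whence τ(n) = n τ(H) ∏_{j≠0} R(t_j).

Both conclusions follow from this identity. The product is a rational algebraic integer, hence an
integer: this is the divisibility. Multiplying by R(2) completes the product to all j; factoring R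
over its roots 2w_p and exchanging products turns the factor of w_p into 2T_n(w_p) - 2 up to sign.
The leading coefficient of R is ±η, and η > 0 by connectedness, which also fixes the number of
roots. -/

namespace CirculantFoliation

open Matrix

/-! ### Cauchy–Binet, summed over all maps instead of subsets -/

section CauchyBinet

variable {V E R : Type*} [Fintype V] [DecidableEq V] [Fintype E] [CommRing R]

theorem det_mul_eq_sum_prod_mul_det (B : Matrix V E R) (C : Matrix E V R) :
    (B * C).det = ∑ f : V → E, (∏ i, C (f i) i) * (B.submatrix id f).det := by
  classical
  simp only [det_apply', mul_apply, Finset.prod_univ_sum, Finset.mul_sum, Fintype.piFinset_univ]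
  rw [Finset.sum_comm]
  refine Finset.sum_congr rfl fun f _ => Finset.sum_congr rfl fun σ _ => ?_
  simp only [submatrix_apply, id, Finset.prod_mul_distrib]
  ring

/-- Averages the expansion of `det_mul_eq_sum_prod_mul_det` over all permutations of the columns.
Each set of |V| columns is counted once per enumeration, hence the factorial; no order on `E` is
needed. -/
theorem factorial_mul_det_mul (B : Matrix V E R) (C : Matrix E V R) :
    ((Fintype.card V).factorial : R) * (B * C).det =
      ∑ f : V → E, (B.submatrix id f).det * (C.submatrix f id).det := by
  classical
  have h : ∀ σ : Equiv.Perm V, (B * C).det =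
      ∑ f : V → E, (B.submatrix id f).det * ((Equiv.Perm.sign σ : ℤ) * ∏ i, C (f (σ i)) i) := by
    intro σ
    rw [det_mul_eq_sum_prod_mul_det, ← Equiv.sum_comp (Equiv.arrowCongr σ.symm (Equiv.refl E))
      (fun f : V → E => (∏ i, C (f i) i) * (B.submatrix id f).det)]
    refine Finset.sum_congr rfl fun f _ => ?_
    have : B.submatrix id ((Equiv.arrowCongr σ.symm (Equiv.refl E)) f) =
        (B.submatrix id f).submatrix id σ := by
      ext i j; simp [Equiv.arrowCongr]
    rw [this, det_permute']
    simp [Equiv.arrowCongr]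
    ring
  have h2 : ∑ σ : Equiv.Perm V, (B * C).det = ((Fintype.card V).factorial : R) * (B * C).det := by
    simp [Fintype.card_perm]
  refine h2.symm.trans ((Finset.sum_congr rfl fun σ _ => h σ).trans ?_)
  rw [Finset.sum_comm]
  refine Finset.sum_congr rfl fun f _ => ?_
  rw [← Finset.mul_sum]
  congr 1
  simp [det_apply' (C.submatrix f id)]

end CauchyBinet

/-! ### Unimodularity of incidence matrices -/

section Unimodular

variable {V : Type*} [Fintype V] [DecidableEq V]

/-- A column is a difference of two unit vectors, either of which may be missing (`none`). If some
column has at most one nonzero entry, expand along it and induct. Otherwise every column sums to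
zero and the determinant vanishes. -/
theorem det_fin_optionDiff (k : ℕ) : ∀ (a b : Fin k → Option (Fin k)),
    (Matrix.of fun i j => ((if a j = some i then 1 else 0) - if b j = some i then 1 else 0 : ℤ)).det
      ∈ ({0, 1, -1} : Set ℤ) := by
  induction k with
  | zero => intro a b; simp
  | succ k ih =>
    intro a b
    set A : Matrix (Fin (k + 1)) (Fin (k + 1)) ℤ := Matrix.of fun i j =>
      ((if a j = some i then 1 else 0) - if b j = some i then 1 else 0 : ℤ) with hA
    by_cases h : ∃ j i₀, ∀ i, i ≠ i₀ → A i j = 0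
    · obtain ⟨j, i₀, h⟩ := h
      rw [det_succ_column A j, Finset.sum_eq_single i₀ (fun i _ hi => by simp [h i hi]) (by simp)]
      have hentry : A i₀ j ∈ ({0, 1, -1} : Set ℤ) := by
        simp only [hA, of_apply]; split_ifs <;> simp
      have hminor : (A.submatrix i₀.succAbove j.succAbove).det ∈ ({0, 1, -1} : Set ℤ) := by
        -- Deleting row `i₀` turns the end `some i₀` into `none`, so the minor has the same shape.
        have key : ∀ (o : Option (Fin (k + 1))) (i : Fin k),
            (o = some (i₀.succAbove i)) ↔
              (o.bind (fun t => if h : ∃ i, i₀.succAbove i = t then some h.choose else none)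
                = some i) := by
          intro o i
          rcases o with _ | t
          · simp
          · by_cases ht : ∃ i, i₀.succAbove i = t
            · have := ht.choose_spec
              simp only [Option.some.injEq, Option.bind_some, ht, dite_true]
              constructor
              · intro h; exact Fin.succAbove_right_injective (this.trans h)
              · intro h; rw [← h, this]
            · simp only [Option.some.injEq, Option.bind_some, ht, dite_false]
              constructor
              · intro h; exact absurd ⟨i, h.symm⟩ ht
              · intro h; simp at h
        have e : A.submatrix i₀.succAbove j.succAbove = Matrix.of fun i j' =>
            ((if (a (j.succAbove j')).bind (fun t => if h : ∃ i, i₀.succAbove i = t then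
                some h.choose else none) = some i then 1 else 0) -
              if (b (j.succAbove j')).bind (fun t => if h : ∃ i, i₀.succAbove i = t then
                some h.choose else none) = some i then 1 else 0 : ℤ) := by
          ext i j'
          simp only [hA, submatrix_apply, of_apply, key]
        rw [e]
        exact ih _ _
      rcases neg_one_pow_eq_or ℤ ((i₀ : ℕ) + (j : ℕ)) with h1 | h1 <;>
      rcases hentry with h2 | h2 | h2 <;> rcases hminor with h3 | h3 | h3 <;>
      simp_all
    · left
      refine exists_vecMul_eq_zero_iff.mp ⟨fun _ => (1 : ℤ), fun h0 => ?_, ?_⟩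
      · exact one_ne_zero (congrFun h0 0)
      · ext j
        simp only [vecMul, dotProduct, one_mul, Pi.zero_apply]
        rcases ha : a j with _ | p
        · rcases hb : b j with _ | q
          · exact absurd ⟨j, 0, fun i _ => by simp [hA, ha, hb]⟩ h
          · exact absurd ⟨j, q, fun i hi => by simp [hA, ha, hb, hi.symm]⟩ h
        · rcases hb : b j with _ | q
          · exact absurd ⟨j, p, fun i hi => by simp [hA, ha, hb, hi.symm]⟩ h
          · simp [hA, ha, hb, Finset.sum_sub_distrib]

theorem det_optionDiff (a b : V → Option V) :
    (Matrix.of fun i j => ((if a j = some i then 1 else 0) - if b j = some i then 1 else 0 : ℤ)).det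
      ∈ ({0, 1, -1} : Set ℤ) := by
  have e := Fintype.equivFin V
  rw [← det_reindex_self e]
  convert det_fin_optionDiff (Fintype.card V) (fun j => (a (e.symm j)).map e)
    (fun j => (b (e.symm j)).map e) using 2
  ext i j
  have key : ∀ o : Option V, o = some (e.symm i) ↔ o.map e = some i := by
    rintro (_ | t) <;> simp [Equiv.eq_symm_apply]
  simp [reindex_apply, key]

end Unimodular

/-! ### Edge sets with prescribed ends -/

section Edges

variable {V ι : Type*} (x y : ι → V)

/-- Adjacency through an edge of `S`, where the edge `i` has the ends `x i` and `y i`. -/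
def EdgeAdj (S : Set ι) (u v : V) : Prop :=
  ∃ i ∈ S, s(u, v) = s(x i, y i)

/-- The edge set `S` connects any two vertices. -/
def EdgeConnected (S : Set ι) : Prop :=
  ∀ u v, Relation.ReflTransGen (EdgeAdj x y S) u v

/-- The edge set `S` contains a cycle. -/
def HasEdgeCycle (S : Set ι) : Prop :=
  ∃ (k : ℕ) (v : ℕ → V) (e : ℕ → ι), 1 ≤ k ∧ v k = v 0 ∧
    Set.InjOn v (Set.Iio k) ∧ Set.InjOn e (Set.Iio k) ∧
    ∀ i < k, e i ∈ S ∧ s(v i, v (i + 1)) = s(x (e i), y (e i))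

/-- The edge set `S` is connected and contains no cycle. -/
def IsTreeSet (S : Set ι) : Prop :=
  EdgeConnected x y S ∧ ¬ HasEdgeCycle x y S

variable {x y}

theorem EdgeAdj.symm {S : Set ι} {u v : V} (h : EdgeAdj x y S u v) : EdgeAdj x y S v u := by
  obtain ⟨i, hi, h⟩ := h
  exact ⟨i, hi, Sym2.eq_swap.trans h⟩

theorem EdgeConnected.eq_of_forall_eq {S : Set ι} (hS : EdgeConnected x y S) {M : Type*}
    (z : V → M) (hz : ∀ i ∈ S, z (x i) = z (y i)) (u v : V) : z u = z v := by
  have : ∀ v, Relation.ReflTransGen (EdgeAdj x y S) u v → z u = z v := by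
    intro v h
    induction h with
    | refl => rfl
    | tail _ h ih =>
      obtain ⟨i, hi, h⟩ := h
      rcases Sym2.eq_iff.mp h with ⟨rfl, rfl⟩ | ⟨rfl, rfl⟩
      · exact ih.trans (hz i hi)
      · exact ih.trans (hz i hi).symm
  exact this v (hS u v)

/-- A path in `S` between the ends of the new edge is closed up by that edge. Passing to a simple
graph makes a path with distinct vertices available. -/
theorem EdgeConnected.hasEdgeCycle_insert {S : Set ι} (hS : EdgeConnected x y S) {i : ι}
    (hi : i ∉ S) : HasEdgeCycle x y (insert i S) := by
  classical
  let Γ : SimpleGraph V := SimpleGraph.fromRel (EdgeAdj x y S)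
  have hreach : Γ.Reachable (y i) (x i) := by
    have h := hS (y i) (x i)
    generalize x i = w at h
    induction h with
    | refl => exact SimpleGraph.Reachable.refl _
    | @tail b c _ h ih =>
      by_cases hbc : b = c
      · exact hbc ▸ ih
      · exact ih.trans (SimpleGraph.Adj.reachable
          ((SimpleGraph.fromRel_adj _ _ _).mpr ⟨hbc, Or.inl h⟩))
  obtain ⟨p, hp⟩ := hreach.exists_isPath
  have hadj : ∀ m, m < p.length → EdgeAdj x y S (p.getVert m) (p.getVert (m + 1)) := by
    intro m hm
    rcases ((SimpleGraph.fromRel_adj _ _ _).mp (p.adj_getVert_succ hm)).2 with h | h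
    · exact h
    · exact h.symm
  have hinj : Set.InjOn p.getVert {m | m ≤ p.length} := hp.getVert_injOn
  have : Nonempty ι := ⟨i⟩
  choose! e he hlink using hadj
  -- The path runs from `y i` to `x i`; the new edge, at position `p.length`, returns to `y i`.
  refine ⟨p.length + 1, fun m => if m ≤ p.length then p.getVert m else y i,
    fun m => if m < p.length then e m else i, by omega, by simp, ?_, ?_, ?_⟩
  · intro a ha b hb hab
    have ha' : a ≤ p.length := Nat.lt_succ_iff.mp ha
    have hb' : b ≤ p.length := Nat.lt_succ_iff.mp hb
    simp only [ha', hb', if_true] at hab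
    exact hinj ha' hb' hab
  · intro a ha b hb hab
    have ha' : a ≤ p.length := Nat.lt_succ_iff.mp ha
    have hb' : b ≤ p.length := Nat.lt_succ_iff.mp hb
    by_cases ha1 : a < p.length <;> by_cases hb1 : b < p.length
    · simp only [ha1, hb1, if_true] at hab
      have h := (hlink a ha1).trans ((congrArg (fun t => s(x t, y t)) hab).trans
        (hlink b hb1).symm)
      rcases Sym2.eq_iff.mp h with ⟨h1, -⟩ | ⟨h1, h2⟩
      · exact hinj ha' hb' h1
      -- An edge used in opposite directions would force a = b + 1 and b = a + 1.
      · have := hinj (show a ≤ _ from ha') (show b + 1 ≤ _ from hb1) h1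
        have := hinj (show a + 1 ≤ _ from ha1) (show b ≤ _ from hb') h2
        omega
    · simp only [ha1, hb1, if_true, if_false] at hab
      exact absurd (hab ▸ he a ha1) hi
    · simp only [ha1, hb1, if_true, if_false] at hab
      exact absurd (hab ▸ he b hb1) hi
    · omega
  · intro m hm
    by_cases hm1 : m < p.length
    · have h1 : m ≤ p.length := hm1.le
      have h2 : m + 1 ≤ p.length := hm1
      simp only [hm1, h1, h2, if_true]
      exact ⟨Or.inr (he m hm1), hlink m hm1⟩
    · have h1 : m = p.length := by omega
      subst h1
      simp

end Edges

/-! ### The rooted incidence matrix -/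

section Incidence

variable {V ι : Type*} [Fintype V] [DecidableEq V] (x y : ι → V) (r : V)

/-- The incidence matrix of the oriented edges `x i → y i`, with one additional column,
the unit vector at the root `r`. -/
def rootedIncidence : Matrix V (Option ι) ℤ :=
  Matrix.of fun v o => (if o.elim (some r) (some ∘ x) = some v then 1 else 0) -
    (if o.elim none (some ∘ y) = some v then 1 else 0)

variable {x y r}

@[simp]
theorem vecMul_rootedIncidence_none (z : V → ℤ) : (z ᵥ* rootedIncidence x y r) none = z r := by
  simp [rootedIncidence, vecMul, dotProduct]

@[simp]
theorem vecMul_rootedIncidence_some (z : V → ℤ) (i : ι) :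
    (z ᵥ* rootedIncidence x y r) (some i) = z (x i) - z (y i) := by
  simp [rootedIncidence, vecMul, dotProduct, mul_sub, Finset.sum_sub_distrib]

theorem det_rootedIncidence_mem (f : V → Option ι) :
    ((rootedIncidence x y r).submatrix id f).det ∈ ({0, 1, -1} : Set ℤ) :=
  det_optionDiff (fun j => (f j).elim (some r) (some ∘ x)) (fun j => (f j).elim none (some ∘ y))

theorem eq_zero_of_det_rootedIncidence_ne_zero {f : V → Option ι}
    (hf : ((rootedIncidence x y r).submatrix id f).det ≠ 0) (z : V → ℤ)
    (hz : ∀ j, (z ᵥ* rootedIncidence x y r) (f j) = 0) : z = 0 := by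
  by_contra h
  exact hf (exists_vecMul_eq_zero_iff.mp ⟨z, h, funext hz⟩)

/-- The all-ones row vector kills every edge column, so a nonsingular choice must use the root
column. -/
theorem none_mem_range_of_det_ne_zero {f : V → Option ι}
    (hf : ((rootedIncidence x y r).submatrix id f).det ≠ 0) : none ∈ Set.range f := by
  by_contra h
  have := eq_zero_of_det_rootedIncidence_ne_zero hf (fun _ => 1) fun j => by
    rcases hj : f j with _ | i
    · exact absurd ⟨j, hj⟩ h
    · simp
  exact one_ne_zero (congrFun this r)

/-- The indicator of the vertices not reachable from the root kills all chosen columns, so it is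
zero. -/
theorem edgeConnected_of_det_ne_zero {f : V → Option ι}
    (hf : ((rootedIncidence x y r).submatrix id f).det ≠ 0) :
    EdgeConnected x y {i | some i ∈ Set.range f} := by
  classical
  set S : Set ι := {i | some i ∈ Set.range f} with hS
  have hsymm : ∀ u v, Relation.ReflTransGen (EdgeAdj x y S) u v →
      Relation.ReflTransGen (EdgeAdj x y S) v u := by
    intro u v h
    induction h with
    | refl => exact .refl
    | tail _ h ih => exact .head h.symm ih
  have hr : ∀ v, Relation.ReflTransGen (EdgeAdj x y S) r v := by
    have := eq_zero_of_det_rootedIncidence_ne_zero hf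
      (fun v => if Relation.ReflTransGen (EdgeAdj x y S) r v then 0 else 1) fun j => by
        rcases hj : f j with _ | i
        · simp [Relation.ReflTransGen.refl]
        · have hi : EdgeAdj x y S (x i) (y i) := ⟨i, ⟨j, hj⟩, rfl⟩
          have : Relation.ReflTransGen (EdgeAdj x y S) r (x i) ↔
              Relation.ReflTransGen (EdgeAdj x y S) r (y i) :=
            ⟨fun h => h.tail hi, fun h => h.tail hi.symm⟩
          simp [this]
    intro v
    by_contra hv
    have := congrFun this v
    simp [hv] at this
  exact fun u v => (hsymm _ _ (hr u)).trans (hr v)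

theorem injective_of_det_ne_zero {f : V → Option ι}
    (hf : ((rootedIncidence x y r).submatrix id f).det ≠ 0) : Function.Injective f := by
  intro i j hij
  by_contra h
  exact hf (det_zero_of_column_eq h fun k => by simp [hij])

/-- The columns along a cycle, suitably signed, telescope to zero: a linear dependence, nontrivial
because the edges are distinct. -/
theorem not_hasEdgeCycle_of_det_ne_zero {f : V → Option ι}
    (hf : ((rootedIncidence x y r).submatrix id f).det ≠ 0) :
    ¬ HasEdgeCycle x y {i | some i ∈ Set.range f} := by
  classical
  rintro ⟨k, v, e, hk, hv, -, he, hlink⟩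
  have hmem : ∀ m, m < k → ∃ j, f j = some (e m) := fun m hm => (hlink m hm).1
  have : Nonempty V := ⟨r⟩
  choose! g hg using hmem
  have hsign : ∀ m, m < k → ∃ c : ℤ, c ≠ 0 ∧ ∀ u, c * rootedIncidence x y r u (some (e m)) =
      (if v m = u then 1 else 0) - if v (m + 1) = u then 1 else 0 := by
    intro m hm
    rcases Sym2.eq_iff.mp (hlink m hm).2 with ⟨h1, h2⟩ | ⟨h1, h2⟩
    · exact ⟨1, one_ne_zero, fun u => by simp [rootedIncidence, h1, h2]⟩
    · exact ⟨-1, by simp, fun u => by simp [rootedIncidence, h1, h2]⟩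
  choose! c hc hcol using hsign
  have hginj : ∀ a < k, ∀ b < k, g a = g b → a = b := fun a ha b hb hab =>
    he ha hb (Option.some_injective _ ((hg a ha).symm.trans (hab ▸ hg b hb)))
  have hker : (rootedIncidence x y r).submatrix id f *ᵥ
      (∑ m ∈ Finset.range k, Pi.single (g m) (c m)) = 0 := by
    rw [mulVec_sum]
    ext u
    have : ∀ m ∈ Finset.range k, ((rootedIncidence x y r).submatrix id f *ᵥ
        Pi.single (g m) (c m)) u = (if v m = u then 1 else 0) - if v (m + 1) = u then 1 else 0 := by
      intro m hm
      have hm := Finset.mem_range.mp hm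
      rw [← hcol m hm u]
      simp [hg m hm, mul_comm]
    rw [Finset.sum_apply, Finset.sum_congr rfl this,
      Finset.sum_range_sub' (fun m => if v m = u then (1 : ℤ) else 0), hv]
    simp
  refine hf (exists_mulVec_eq_zero_iff.mp ⟨_, fun h0 => ?_, hker⟩)
  have := congrFun h0 (g 0)
  rw [Finset.sum_apply, Finset.sum_eq_single 0] at this
  · exact hc 0 hk (by simpa using this)
  · intro m hm hm0
    rw [Pi.single_apply, if_neg]
    exact fun h => hm0 (hginj _ (Finset.mem_range.mp hm) _ hk h.symm)
  · intro h
    exact absurd (Finset.mem_range.mpr hk) h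

theorem EdgeConnected.eq_zero {S : Set ι} (hS : EdgeConnected x y S) (z : V → ℤ)
    (hz : ∀ o ∈ insert none (some '' S), (z ᵥ* rootedIncidence x y r) o = 0) : z = 0 := by
  have h1 : z r = 0 := by simpa using hz none (Set.mem_insert _ _)
  ext v
  rw [hS.eq_of_forall_eq z (fun i hi => ?_) v r, h1]; rfl
  simpa [sub_eq_zero] using hz (some i) (Set.mem_insert_of_mem _ ⟨i, hi, rfl⟩)

theorem EdgeConnected.det_ne_zero {S : Set ι} (hS : EdgeConnected x y S) {f : V → Option ι}
    (hf : insert none (some '' S) ⊆ Set.range f) :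
    ((rootedIncidence x y r).submatrix id f).det ≠ 0 := by
  intro h
  obtain ⟨z, hz, h0⟩ := exists_vecMul_eq_zero_iff.mpr h
  refine hz (hS.eq_zero (r := r) z fun o ho => ?_)
  obtain ⟨j, rfl⟩ := hf ho
  exact congrFun h0 j

/-- The columns of `S` and the root have trivial left kernel, so B Bᵀ is nonsingular, because z B Bᵀ
zᵀ is a sum of squares. By Cauchy–Binet some maximal minor of B is nonzero. -/
theorem EdgeConnected.exists_det_ne_zero [Finite ι] {S : Set ι} (hS : EdgeConnected x y S) :
    ∃ f : V → Option ι, Set.range f ⊆ insert none (some '' S) ∧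
      ((rootedIncidence x y r).submatrix id f).det ≠ 0 := by
  classical
  let T : Set (Option ι) := insert none (some '' S)
  have := Fintype.ofFinite T
  let B : Matrix V T ℤ := (rootedIncidence x y r).submatrix id Subtype.val
  have hdet : (B * Bᵀ).det ≠ 0 := by
    intro h
    obtain ⟨z, hz, h0⟩ := exists_vecMul_eq_zero_iff.mpr h
    refine hz (hS.eq_zero (r := r) z fun o ho => ?_)
    have h1 : (z ᵥ* B) ⬝ᵥ (z ᵥ* B) = 0 := by
      rw [← vecMul_vecMul, vecMul_transpose] at h0
      rw [← dotProduct_mulVec, h0, dotProduct_zero]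
    exact congrFun (dotProduct_self_eq_zero.mp h1) ⟨o, ho⟩
  by_contra! hcon
  apply hdet
  have h := factorial_mul_det_mul B Bᵀ
  rw [Finset.sum_eq_zero] at h
  · exact (mul_eq_zero.mp h).resolve_left (by exact_mod_cast Nat.factorial_ne_zero _)
  · intro f _
    have := hcon (fun v => (f v).1) (by rintro _ ⟨v, rfl⟩; exact (f v).2)
    rw [show B.submatrix id f = (rootedIncidence x y r).submatrix id (fun v => (f v).1) from rfl,
      this, zero_mul]

/-- If a nonsingular choice omitted an edge of the tree, the chosen edges would already be
connected, and adding the omitted one would create a cycle inside `S`. -/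
theorem IsTreeSet.exists_det_ne_zero [Finite ι] {S : Set ι} (hS : IsTreeSet x y S) :
    ∃ f : V → Option ι, Set.range f = insert none (some '' S) ∧
      ((rootedIncidence x y r).submatrix id f).det ≠ 0 := by
  obtain ⟨f, hf, hdet⟩ := hS.1.exists_det_ne_zero (r := r)
  refine ⟨f, hf.antisymm ?_, hdet⟩
  rintro o (rfl | ⟨i, hi, rfl⟩)
  · exact none_mem_range_of_det_ne_zero hdet
  · by_contra h
    obtain ⟨k, v, e, h1, h2, h3, h4, h5⟩ :=
      (edgeConnected_of_det_ne_zero hdet).hasEdgeCycle_insert (i := i) h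
    refine hS.2 ⟨k, v, e, h1, h2, h3, h4, fun m hm => ⟨?_, (h5 m hm).2⟩⟩
    rcases (h5 m hm).1 with h | h
    · exact h ▸ hi
    · rcases hf h with h | ⟨j, hj, h⟩
      · simp at h
      · exact Option.some_injective _ h ▸ hj

theorem det_ne_zero_iff_isTreeSet {f : V → Option ι} :
    ((rootedIncidence x y r).submatrix id f).det ≠ 0 ↔
      ∃ S, IsTreeSet x y S ∧ Function.Injective f ∧ Set.range f = insert none (some '' S) := by
  constructor
  · intro h
    refine ⟨{i | some i ∈ Set.range f},
      ⟨edgeConnected_of_det_ne_zero h, not_hasEdgeCycle_of_det_ne_zero h⟩,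
      injective_of_det_ne_zero h, ?_⟩
    ext (_ | i)
    · simpa using none_mem_range_of_det_ne_zero h
    · simp
  · rintro ⟨S, hS, -, hr⟩
    exact hS.1.det_ne_zero hr.ge

/-- This count cancels the factorial in `factorial_mul_det_mul`. -/
theorem IsTreeSet.card_injective_range_eq [Finite ι] {S : Set ι} (hS : IsTreeSet x y S) [Nonempty V] :
    Nat.card {f : V → Option ι // Function.Injective f ∧ Set.range f = insert none (some '' S)} =
      (Fintype.card V).factorial := by
  classical
  set T : Set (Option ι) := insert none (some '' S) with hT
  have := Fintype.ofFinite T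
  obtain ⟨f₀, h₀, hdet⟩ := hS.exists_det_ne_zero (r := Classical.arbitrary V)
  let e : V ≃ T := (Equiv.ofInjective f₀ (injective_of_det_ne_zero hdet)).trans
    (Equiv.setCongr h₀)
  let E : {f : V → Option ι // Function.Injective f ∧ Set.range f = T} ≃ (V ≃ T) :=
    { toFun := fun f => (Equiv.ofInjective f.1 f.2.1).trans (Equiv.setCongr f.2.2)
      invFun := fun g => ⟨fun v => (g v).1, Subtype.val_injective.comp g.injective, by
        ext o
        exact ⟨fun ⟨v, hv⟩ => hv ▸ (g v).2, fun ho => ⟨g.symm ⟨o, ho⟩, by simp⟩⟩⟩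
      left_inv := fun f => rfl
      right_inv := fun g => by ext v; rfl }
  rw [Nat.card_congr E, Nat.card_eq_fintype_card, Fintype.card_equiv e]

/-- In Cauchy–Binet only enumerations of tree sets together with the root survive, each contributing
(±1)² = 1. -/
theorem det_rootedIncidence_mul_transpose [Fintype ι] :
    (rootedIncidence x y r * (rootedIncidence x y r)ᵀ).det = {S | IsTreeSet x y S}.ncard := by
  classical
  have : Nonempty V := ⟨r⟩
  have hfac : ((Fintype.card V).factorial : ℤ) ≠ 0 := by exact_mod_cast Nat.factorial_ne_zero _
  apply mul_left_cancel₀ hfac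
  rw [factorial_mul_det_mul]
  let F := Finset.univ.filter fun S : Set ι => IsTreeSet x y S
  have hF : {S | IsTreeSet x y S}.ncard = F.card := by
    rw [← Set.ncard_coe_finset]; congr; ext; simp [F]
  have key : ∀ f : V → Option ι, ((rootedIncidence x y r).submatrix id f).det *
      ((rootedIncidence x y r)ᵀ.submatrix f id).det =
      ∑ S ∈ F, if Function.Injective f ∧ Set.range f = insert none (some '' S) then (1 : ℤ)
        else 0 := by
    intro f
    rw [← transpose_submatrix, det_transpose]
    by_cases h : ((rootedIncidence x y r).submatrix id f).det = 0
    · rw [h, zero_mul, Finset.sum_eq_zero]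
      intro S hS
      rw [if_neg]
      exact fun h' => det_ne_zero_iff_isTreeSet.mpr ⟨S, (Finset.mem_filter.mp hS).2, h'⟩ h
    · obtain ⟨S, hS, h1, h2⟩ := det_ne_zero_iff_isTreeSet.mp h
      rw [Finset.sum_eq_single S]
      · rw [if_pos ⟨h1, h2⟩]
        rcases det_rootedIncidence_mem (x := x) (y := y) (r := r) f with h3 | h3 | h3
        · exact absurd h3 h
        · rw [h3]; rfl
        · rw [h3]; rfl
      · intro S' _ hne
        rw [if_neg]
        rintro ⟨-, h3⟩
        apply hne
        ext i
        have := Set.ext_iff.mp (h3.symm.trans h2) (some i)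
        simpa using this
      · exact fun h' => absurd (Finset.mem_filter.mpr ⟨Finset.mem_univ _, hS⟩) h'
  rw [Finset.sum_congr rfl fun f _ => key f, Finset.sum_comm, hF, mul_comm, ← nsmul_eq_mul,
    ← Finset.sum_const]
  refine Finset.sum_congr rfl fun S hS => ?_
  rw [Finset.sum_boole, ← (Finset.mem_filter.mp hS).2.card_injective_range_eq, Nat.card_eq_fintype_card,
    Fintype.card_subtype]

end Incidence

/-! ### The matrix-tree theorem -/

section MatrixTree

variable {V β ι : Type*}

/-- `en` enumerates the edges of `G`, a graph on the whole of `V`, without repetition,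
and the edge `en i` has the ends `x i` and `y i`. -/
structure IsEdgeEnumeration (G : Graph V β) (en : ι → β) (x y : ι → V) : Prop where
  vertexSet_eq : G.vertexSet = Set.univ
  injective : Function.Injective en
  exists_eq : ∀ e ∈ G.edgeSet, ∃ i, en i = e
  isLink : ∀ i, G.IsLink (en i) (x i) (y i)

namespace IsEdgeEnumeration

variable {G : Graph V β} {en : ι → β} {x y : ι → V} (h : IsEdgeEnumeration G en x y)

theorem isLink_iff (h : IsEdgeEnumeration G en x y) (i : ι) (u v : V) :
    G.IsLink (en i) u v ↔ s(u, v) = s(x i, y i) := by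
  constructor
  · intro h1
    rw [Sym2.eq_iff]
    exact h1.eq_and_eq_or_eq_and_eq (h.isLink i)
  · intro h1
    rcases Sym2.eq_iff.mp h1 with ⟨rfl, rfl⟩ | ⟨rfl, rfl⟩
    · exact h.isLink i
    · exact (h.isLink i).symm

/-- The spanning subgraph with the edges indexed by `S`. -/
def subgraph (_ : IsEdgeEnumeration G en x y) (S : Set ι) : Graph V β where
  vertexSet := Set.univ
  IsLink e u v := (∃ i ∈ S, en i = e) ∧ G.IsLink e u v
  isLink_symm := fun _ _ => ⟨fun _ _ h1 => ⟨h1.1, h1.2.symm⟩⟩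
  eq_or_eq_of_isLink_of_isLink := fun _ _ _ _ _ h1 h2 => h1.2.left_eq_or_eq h2.2
  left_mem_of_isLink := fun _ _ _ _ => Set.mem_univ _

theorem subgraph_isLink {S : Set ι} {i : ι} {u v : V} :
    (h.subgraph S).IsLink (en i) u v ↔ i ∈ S ∧ s(u, v) = s(x i, y i) := by
  rw [← h.isLink_iff]
  constructor
  · rintro ⟨⟨j, hj, hij⟩, h2⟩
    exact ⟨h.injective hij ▸ hj, h2⟩
  · rintro ⟨h1, h2⟩
    exact ⟨⟨i, h1, rfl⟩, h2⟩

theorem subgraph_injective : Function.Injective h.subgraph := by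
  intro S S' hS
  ext i
  have h1 := h.subgraph_isLink (S := S) (i := i) (u := x i) (v := y i)
  rw [hS, h.subgraph_isLink] at h1
  simpa using h1.symm

theorem subgraph_isSpanningSubgraph (S : Set ι) : (h.subgraph S).IsSpanningSubgraph G :=
  ⟨⟨h.vertexSet_eq.ge, fun _ _ _ h1 => h1.2⟩, h.vertexSet_eq.symm⟩

theorem exists_subgraph_eq {T : Graph V β} (hT : T.IsSpanningSubgraph G) :
    ∃ S, h.subgraph S = T := by
  refine ⟨{i | en i ∈ T.edgeSet}, Graph.ext ?_ ?_⟩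
  · rw [hT.vertexSet_eq, h.vertexSet_eq]; rfl
  · intro e u v
    constructor
    · rintro ⟨⟨i, hi, rfl⟩, h2⟩
      exact (Graph.IsSubgraph.isLink_iff hT.le hi).mpr h2
    · intro h1
      have h2 : G.IsLink e u v := h1.mono hT.le
      obtain ⟨i, rfl⟩ := h.exists_eq e h2.edge_mem
      exact ⟨⟨i, h1.edge_mem, rfl⟩, h2⟩

theorem exists_eq_of_subgraph_isLink {S : Set ι} {e : β} {u v : V}
    (h1 : (h.subgraph S).IsLink e u v) : ∃ i ∈ S, en i = e ∧ s(u, v) = s(x i, y i) := by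
  obtain ⟨i, hi, rfl⟩ := h1.1
  exact ⟨i, hi, rfl, (h.isLink_iff i u v).mp h1.2⟩

theorem isTree_subgraph_iff [Nonempty V] (S : Set ι) :
    IsTree (h.subgraph S) ↔ IsTreeSet x y S := by
  have hadj : (h.subgraph S).Adj = EdgeAdj x y S := by
    ext u v
    constructor
    · rintro ⟨e, he⟩
      obtain ⟨i, hi, -, h1⟩ := h.exists_eq_of_subgraph_isLink he
      exact ⟨i, hi, h1⟩
    · rintro ⟨i, hi, h1⟩
      exact ⟨en i, h.subgraph_isLink.mpr ⟨hi, h1⟩⟩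
  have hvert : (h.subgraph S).vertexSet = Set.univ := rfl
  refine and_congr ?_ (not_congr ?_)
  · simp only [IsConnected, EdgeConnected, hadj, hvert, Set.univ_nonempty, Set.mem_univ,
      true_and, forall_const]
  · constructor
    · rintro ⟨k, v, e, hk, hv, hvi, hei, hl⟩
      have hl' := fun m (hm : m < k) => h.exists_eq_of_subgraph_isLink (hl m hm)
      have : Nonempty ι := ⟨(hl' 0 hk).choose⟩
      choose! e' he' hee hs using hl'
      refine ⟨k, v, e', hk, hv, hvi, fun a ha b hb hab => hei ha hb ?_,
        fun m hm => ⟨he' m hm, hs m hm⟩⟩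
      rw [← hee a ha, ← hee b hb, hab]
    · rintro ⟨k, v, e, hk, hv, hvi, hei, hl⟩
      exact ⟨k, v, en ∘ e, hk, hv, hvi, fun a ha b hb hab => hei ha hb (h.injective hab),
        fun m hm => h.subgraph_isLink.mpr (hl m hm)⟩

theorem numSpanningTrees_eq [Nonempty V] (h : IsEdgeEnumeration G en x y) :
    numSpanningTrees G = {S | IsTreeSet x y S}.ncard := by
  rw [← Set.ncard_image_of_injective _ h.subgraph_injective, numSpanningTrees]
  congr 1
  ext T
  constructor
  · rintro ⟨h1, h2⟩
    obtain ⟨S, rfl⟩ := h.exists_subgraph_eq h1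
    exact ⟨S, (h.isTree_subgraph_iff S).mp h2, rfl⟩
  · rintro ⟨S, hS, rfl⟩
    exact ⟨h.subgraph_isSpanningSubgraph S, (h.isTree_subgraph_iff S).mpr hS⟩

end IsEdgeEnumeration

variable [DecidableEq V] [Fintype ι]

/-- The Laplacian matrix of the graph whose edge `i` has the ends `x i` and `y i`. -/
def edgeLaplacian (R : Type*) [CommRing R] (x y : ι → V) : Matrix V V R :=
  Matrix.of fun u v => ∑ i, ((Pi.single (x i) 1 : V → R) u - (Pi.single (y i) 1 : V → R) u) *
    ((Pi.single (x i) 1 : V → R) v - (Pi.single (y i) 1 : V → R) v)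

variable {R : Type*} [CommRing R] {x y : ι → V}

theorem edgeLaplacian_map {R' : Type*} [CommRing R'] (φ : R →+* R') :
    (edgeLaplacian R x y).map φ = edgeLaplacian R' x y := by
  ext u v
  simp [edgeLaplacian, Pi.single_apply, apply_ite φ]

theorem edgeLaplacian_transpose : (edgeLaplacian R x y)ᵀ = edgeLaplacian R x y := by
  ext u v
  simp [edgeLaplacian, mul_comm]

theorem rootedIncidence_mul_transpose (r : V) :
    rootedIncidence x y r * (rootedIncidence x y r)ᵀ =
      edgeLaplacian ℤ x y + Matrix.single r r 1 := by
  ext u v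
  rw [mul_apply, Fintype.sum_option]
  simp [rootedIncidence, edgeLaplacian, Matrix.single_apply, Pi.single_apply, eq_comm, add_comm]
  rw [ite_and]
  split_ifs <;> rfl

variable [Fintype V]

theorem edgeLaplacian_mulVec (f : V → R) (u : V) :
    (edgeLaplacian R x y *ᵥ f) u =
      ∑ i, ((Pi.single (x i) 1 : V → R) u - (Pi.single (y i) 1 : V → R) u) *
        (f (x i) - f (y i)) := by
  simp only [mulVec, dotProduct, edgeLaplacian, of_apply, Finset.sum_mul]
  rw [Finset.sum_comm]
  refine Finset.sum_congr rfl fun i _ => ?_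
  simp only [mul_assoc]
  rw [← Finset.mul_sum]
  simp [sub_mul, Finset.sum_sub_distrib, Pi.single_apply]

theorem edgeLaplacian_mulVec_one : edgeLaplacian R x y *ᵥ 1 = 0 := by
  ext u
  simp [edgeLaplacian_mulVec]

theorem one_vecMul_edgeLaplacian : 1 ᵥ* edgeLaplacian R x y = 0 := by
  rw [← mulVec_transpose, edgeLaplacian_transpose, edgeLaplacian_mulVec_one]

theorem edgeLaplacian_quadratic (f : V → R) :
    f ⬝ᵥ (edgeLaplacian R x y *ᵥ f) = ∑ i, (f (x i) - f (y i)) ^ 2 := by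
  simp only [dotProduct, edgeLaplacian_mulVec, Finset.mul_sum]
  rw [Finset.sum_comm]
  refine Finset.sum_congr rfl fun i _ => ?_
  simp only [← mul_assoc]
  rw [← Finset.sum_mul]
  simp [mul_sub, Finset.sum_sub_distrib, Pi.single_apply]
  ring

theorem det_edgeLaplacian [Nonempty V] : (edgeLaplacian R x y).det = 0 := by
  have h : (edgeLaplacian ℤ x y).det = 0 :=
    exists_mulVec_eq_zero_iff.mp ⟨1, one_ne_zero, edgeLaplacian_mulVec_one⟩
  rw [← edgeLaplacian_map (Int.castRingHom R), ← RingHom.mapMatrix_apply, ← RingHom.map_det, h,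
    map_zero]

/-- Linearity in column `r`; the term without `c` is the determinant of the singular Laplacian. -/
theorem det_edgeLaplacian_add_single (r : V) (c : R) :
    (edgeLaplacian R x y + Matrix.single r r c).det =
      c * ((edgeLaplacian R x y).updateCol r (Pi.single r 1)).det := by
  have : Nonempty V := ⟨r⟩
  have : edgeLaplacian R x y + Matrix.single r r c = (edgeLaplacian R x y).updateCol r
      ((edgeLaplacian R x y).col r + c • Pi.single r 1) := by
    ext i j
    by_cases hj : j = r
    · subst hj
      by_cases hi : i = j
      · simp [hi]
      · simp [hi, Ne.symm hi]
    · simp [hj, Ne.symm hj]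
  have h0 : (edgeLaplacian R x y).updateCol r ((edgeLaplacian R x y).col r) =
      edgeLaplacian R x y := by
    ext i j
    by_cases h : j = r <;> simp [h]
  rw [this, det_updateCol_add, det_updateCol_smul, h0, det_edgeLaplacian, zero_add]

theorem IsEdgeEnumeration.det_updateCol {G : Graph V β} {en : ι → β}
    (h : IsEdgeEnumeration G en x y) (r : V) :
    ((edgeLaplacian R x y).updateCol r (Pi.single r 1)).det = numSpanningTrees G := by
  have : Nonempty V := ⟨r⟩
  have h1 : ((edgeLaplacian ℤ x y).updateCol r (Pi.single r 1)).det = numSpanningTrees G := by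
    rw [h.numSpanningTrees_eq, ← det_rootedIncidence_mul_transpose (r := r),
      rootedIncidence_mul_transpose, det_edgeLaplacian_add_single, one_mul]
  have h2 := congrArg (Int.castRingHom R) h1
  rw [RingHom.map_det, RingHom.mapMatrix_apply, Matrix.map_updateCol, edgeLaplacian_map] at h2
  convert h2 using 3
  · ext i; simp [Pi.single_apply]
  · simp

/-- Congruence by P = 1 + w 1ᵀ with w = 1 - e_r. P fixes the Laplacian, whose columns sum to zero,
and sends e_r to the all-ones vector, so it carries the perturbation at the root to the constant
matrix. Its determinant is 1 + 1ᵀw = |V|. Unlike the rooted form, the result respects the cyclic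
symmetry of a foliation. -/
theorem IsEdgeEnumeration.det_add_const [Nonempty V] {G : Graph V β} {en : ι → β}
    (h : IsEdgeEnumeration G en x y) (c : R) :
    (edgeLaplacian R x y + Matrix.of fun _ _ => c).det =
      c * (Fintype.card V : R) ^ 2 * numSpanningTrees G := by
  let r : V := Classical.arbitrary V
  let w : V → R := 1 - Pi.single r 1
  have hP : (1 + vecMulVec w 1).det = (Fintype.card V : R) := by
    rw [vecMulVec_eq Unit, det_one_add_replicateCol_mul_replicateRow]
    simp [w]
  have h1 : (1 + vecMulVec w 1) * (edgeLaplacian R x y + Matrix.single r r c) *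
      (1 + vecMulVec w 1)ᵀ = edgeLaplacian R x y + Matrix.of fun _ _ => c := by
    have hs : Matrix.single r r c = c • vecMulVec (Pi.single r 1) (Pi.single r 1) := by
      ext i j
      simp [vecMulVec_apply, Matrix.single_apply, Pi.single_apply]
      by_cases h1 : i = r <;> by_cases h2 : j = r <;> simp [h1, h2, eq_comm]
    have hJ : (Matrix.of fun _ _ => c : Matrix V V R) = c • vecMulVec 1 1 := by
      ext i j; simp
    rw [hs, hJ]
    have e1 : (1 + vecMulVec w 1) * (edgeLaplacian R x y +
        c • vecMulVec (Pi.single r 1) (Pi.single r 1)) =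
        edgeLaplacian R x y + c • vecMulVec 1 (Pi.single r 1) := by
      simp only [add_mul, one_mul, mul_add, vecMulVec_mul, one_vecMul_edgeLaplacian,
        Matrix.mul_smul, vecMul_vecMulVec]
      ext i j
      simp [vecMulVec_apply, w]
      ring
    rw [e1]
    simp only [transpose_add, transpose_one, transpose_vecMulVec, add_mul, mul_add, mul_one,
      mul_vecMulVec, edgeLaplacian_mulVec_one, smul_mulVec, vecMulVec_mulVec]
    ext i j
    simp [w]
    ring
  rw [← h1, det_mul, det_mul, det_transpose, hP, det_edgeLaplacian_add_single, h.det_updateCol]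
  ring

end MatrixTree

/-! ### The Laplacian of a circulant foliation -/

section GenLaplacian

variable {V β ι : Type*} [DecidableEq V] [Fintype ι] {G : Graph V β} {en : ι → β}
  {x y : ι → V} {R : Type*} [CommRing R]

theorem numEdges_comm {V β : Type*} (G : Graph V β) (u v : V) : numEdges G u v = numEdges G v u := by
  simp only [numEdges, Graph.isLink_comm]

theorem IsEdgeEnumeration.numEdges_cast (h : IsEdgeEnumeration G en x y) (u v : V) :
    (numEdges G u v : R) = ∑ i, if s(u, v) = s(x i, y i) then 1 else 0 := by
  rw [Finset.sum_boole, numEdges, ← Set.ncard_coe_finset,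
    ← Set.ncard_image_of_injective _ h.injective]
  congr 2
  ext e
  constructor
  · intro he
    obtain ⟨i, rfl⟩ := h.exists_eq e (Graph.IsLink.edge_mem he)
    exact ⟨i, by simpa using (h.isLink_iff i u v).mp he, rfl⟩
  · rintro ⟨i, hi, rfl⟩
    exact (h.isLink_iff i u v).mpr (by simpa using hi)

theorem IsEdgeEnumeration.edgeLaplacian_apply_ne (h : IsEdgeEnumeration G en x y) {u v : V}
    (huv : u ≠ v) : edgeLaplacian R x y u v = -(numEdges G u v : R) := by
  rw [h.numEdges_cast, ← Finset.sum_neg_distrib]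
  refine Finset.sum_congr rfl fun i _ => ?_
  simp only [Pi.single_apply, Sym2.eq_iff]
  generalize x i = p
  generalize y i = q
  by_cases h1 : u = p <;> by_cases h2 : u = q <;> by_cases h3 : v = p <;> by_cases h4 : v = q <;>
    simp_all

variable [Fintype V]

theorem IsEdgeEnumeration.genLaplacian_eq (h : IsEdgeEnumeration G en x y) (X : V → R) :
    genLaplacian G (fun v => (degree G v : R) + X v) = edgeLaplacian R x y + diagonal X := by
  ext u v
  by_cases huv : u = v
  · subst huv
    -- Zero row sums determine the diagonal entry from the others. A loop cancels between degree and
    -- adjacency on the left.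
    have h1 := congrFun (edgeLaplacian_mulVec_one (R := R) (x := x) (y := y)) u
    simp only [mulVec, dotProduct, Pi.one_apply, mul_one, Pi.zero_apply] at h1
    rw [← Finset.add_sum_erase _ _ (Finset.mem_univ u),
      Finset.sum_congr rfl fun v hv => h.edgeLaplacian_apply_ne (Finset.ne_of_mem_erase hv).symm,
      Finset.sum_neg_distrib, add_neg_eq_zero] at h1
    have h2 : (degree G u : R) = numEdges G u u +
        ∑ v ∈ Finset.univ.erase u, (numEdges G u v : R) := by
      rw [Finset.add_sum_erase _ (fun v => (numEdges G u v : R)) (Finset.mem_univ u), degree]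
      simp [numEdges_comm G u]
    simp only [genLaplacian, Matrix.sub_apply, Matrix.add_apply, diagonal_apply_eq, of_apply, h1, h2]
    ring
  · simp [genLaplacian, huv, h.edgeLaplacian_apply_ne huv]

end GenLaplacian

section Foliation

variable {α β ι : Type*} {H : Graph α β} {en : ι → β} {x y : ι → α} {n : ℕ} {s : α → Finset ℕ}

/-- The edges of the foliation: copies of the edges of `H`, and edges in the fibres. -/
abbrev FoliationEdge (n : ℕ) (s : α → Finset ℕ) (ι : Type*) : Type _ :=
  (ZMod n × ι) ⊕ (Σ i : α, s i × ZMod n)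

/-- The names of the edges of the foliation. -/
def foliationEdgeName (n : ℕ) (s : α → Finset ℕ) (en : ι → β) :
    FoliationEdge n s ι → (ZMod n × β) ⊕ (α × (ZMod n × ℕ)) :=
  Sum.map (Prod.map id en) fun p => (p.1, (p.2.2, p.2.1))

/-- The first end of an edge of the foliation. -/
def foliationEdgeFst (n : ℕ) (s : α → Finset ℕ) (x : ι → α) : FoliationEdge n s ι → ZMod n × α :=
  Sum.elim (fun p => (p.1, x p.2)) fun p => (p.2.2, p.1)

/-- The second end of an edge of the foliation. -/
def foliationEdgeSnd (n : ℕ) (s : α → Finset ℕ) (y : ι → α) : FoliationEdge n s ι → ZMod n × α :=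
  Sum.elim (fun p => (p.1, y p.2)) fun p => (p.2.2 + (p.2.1 : ℕ), p.1)

theorem IsEdgeEnumeration.foliation (h : IsEdgeEnumeration H en x y) :
    IsEdgeEnumeration (foliation n H s) (foliationEdgeName n s en) (foliationEdgeFst n s x)
      (foliationEdgeSnd n s y) where
  vertexSet_eq := by
    ext p
    simp [CirculantFoliation.foliation, h.vertexSet_eq]
  injective := by
    apply Sum.map_injective.mpr
    refine ⟨Function.injective_id.prodMap h.injective, ?_⟩
    rintro ⟨i, ⟨a, ha⟩, k⟩ ⟨i', ⟨a', ha'⟩, k'⟩ h1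
    simp only [Prod.mk.injEq] at h1
    obtain ⟨rfl, rfl, rfl⟩ := h1
    rfl
  exists_eq := by
    rintro (⟨k, e⟩ | ⟨i, k, a⟩) ⟨p, q, hpq⟩
    · obtain ⟨-, -, h3⟩ := hpq
      obtain ⟨j, rfl⟩ := h.exists_eq e h3.edge_mem
      exact ⟨Sum.inl (k, j), rfl⟩
    · obtain ⟨-, -, -, h3, -⟩ := hpq
      exact ⟨Sum.inr ⟨i, ⟨a, h3⟩, k⟩, rfl⟩
  isLink := by
    rintro (⟨k, j⟩ | ⟨i, ⟨a, ha⟩, k⟩)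
    · exact ⟨rfl, rfl, h.isLink j⟩
    · exact ⟨h.vertexSet_eq ▸ Set.mem_univ _, rfl, rfl, ha, rfl⟩

variable [Fintype α] [DecidableEq α] [Fintype ι] [NeZero n]

/-- The eigenvalue of the Laplacian of the circulant graph with jumps `S`
at the character `k ↦ ψ (k * j)`. -/
noncomputable def circulantEigenvalue (n : ℕ) [NeZero n] (S : Finset ℕ) (j : ZMod n) : ℂ :=
  ∑ a ∈ S, (2 - ZMod.stdAddChar ((a : ZMod n) * j) - ZMod.stdAddChar (-((a : ZMod n) * j)))

/-- Copies of edges of H act only on the factor `g`; on a fibre, a character is an eigenvector of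
the circulant Laplacian. -/
theorem edgeLaplacian_foliation_mulVec (j : ZMod n) (g : α → ℂ) (k : ZMod n) (i : α) :
    (edgeLaplacian ℂ (foliationEdgeFst n s x) (foliationEdgeSnd n s y) *ᵥ
      fun p => ZMod.stdAddChar (p.1 * j) * g p.2) (k, i) =
    ZMod.stdAddChar (k * j) * ((edgeLaplacian ℂ x y +
      diagonal fun i => circulantEigenvalue n (s i) j) *ᵥ g) i := by
  rw [edgeLaplacian_mulVec, Fintype.sum_sum_type, add_mulVec, Pi.add_apply, edgeLaplacian_mulVec,
    mulVec_diagonal, mul_add]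
  congr 1
  · rw [Fintype.sum_prod_type, Finset.sum_eq_single k, Finset.mul_sum]
    · refine Finset.sum_congr rfl fun e _ => ?_
      simp [foliationEdgeFst, foliationEdgeSnd, Pi.single_apply]
      ring
    · intro k' _ hk
      refine Finset.sum_eq_zero fun e _ => ?_
      simp [foliationEdgeFst, foliationEdgeSnd, hk.symm]
    · simp
  · rw [Fintype.sum_sigma, Finset.sum_eq_single i, Fintype.sum_prod_type]
    · rw [circulantEigenvalue, Finset.sum_mul, Finset.mul_sum, ← Finset.sum_coe_sort (s i)]
      refine Finset.sum_congr rfl fun a _ => ?_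
      have e1 : ∀ k' : ZMod n, k = k' + (a : ℕ) ↔ k - (a : ℕ) = k' := fun k' =>
        sub_eq_iff_eq_add.symm
      simp only [foliationEdgeFst, foliationEdgeSnd, Sum.elim_inr, Pi.single_apply, Prod.mk.injEq,
        and_true, sub_mul, e1, ite_mul, one_mul, zero_mul, Finset.sum_sub_distrib,
        Finset.sum_ite_eq, Finset.mem_univ, if_true]
      simp only [add_mul, AddChar.map_add_eq_mul, sub_eq_add_neg, neg_mul]
      have e2 : (ZMod.stdAddChar (-(((a : ℕ) : ZMod n) * j)) : ℂ) *
          ZMod.stdAddChar (((a : ℕ) : ZMod n) * j) = 1 := by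
        rw [← AddChar.map_add_eq_mul, neg_add_cancel, AddChar.map_zero_eq_one]
      linear_combination (ZMod.stdAddChar (k * j) * g i : ℂ) * e2
    · intro i' _ hi
      refine Finset.sum_eq_zero fun e _ => ?_
      simp [foliationEdgeFst, foliationEdgeSnd, hi.symm]
    · simp

end Foliation

/-! ### Fourier transform of the Laplacian of a circulant foliation -/

section Fourier

variable {α β ι : Type*} {H : Graph α β} {en : ι → β} {x y : ι → α} {n : ℕ} {s : α → Finset ℕ}
  [Fintype α] [DecidableEq α] [Fintype ι] [NeZero n]

/-- The Fourier matrix of `ZMod n`, acting on functions on `ZMod n × α`. -/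
noncomputable def fourierMatrix (n : ℕ) [NeZero n] (α : Type*) [DecidableEq α] :
    Matrix (ZMod n × α) (ZMod n × α) ℂ :=
  Matrix.of fun p q => ZMod.stdAddChar (p.1 * q.1) * (Pi.single q.2 1 : α → ℂ) p.2

/-- By orthogonality of characters, the conjugate matrix is an inverse up to the factor n. -/
theorem det_fourierMatrix_ne_zero : (fourierMatrix n α).det ≠ 0 := by
  have h : fourierMatrix n α * (Matrix.of fun p q =>
      ZMod.stdAddChar (-(p.1 * q.1)) * (Pi.single q.2 1 : α → ℂ) p.2) =
      (n : ℂ) • (1 : Matrix (ZMod n × α) (ZMod n × α) ℂ) := by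
    ext ⟨k, i⟩ ⟨l, j⟩
    rw [mul_apply, Fintype.sum_prod_type]
    have hs := AddChar.sum_mulShift (k - l) (ZMod.isPrimitive_stdAddChar n)
    simp only [sub_eq_zero] at hs
    have e : ∀ c : ZMod n, ∑ a : α, fourierMatrix n α (k, i) (c, a) *
        (Matrix.of fun p q : ZMod n × α => (ZMod.stdAddChar (-(p.1 * q.1)) : ℂ) *
          (Pi.single q.2 1 : α → ℂ) p.2) (c, a) (l, j) =
        ZMod.stdAddChar (c * (k - l)) * (Pi.single j 1 : α → ℂ) i := by
      intro c
      rw [Finset.sum_eq_single i]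
      · simp only [fourierMatrix, of_apply, Pi.single_eq_same, mul_one]
        rw [← mul_assoc, ← AddChar.map_add_eq_mul]
        congr 3
        ring
      · intro b _ hb
        simp [fourierMatrix, Pi.single_apply, hb.symm]
      · simp
    rw [Finset.sum_congr rfl fun c _ => e c, ← Finset.sum_mul, hs]
    by_cases h1 : k = l <;> by_cases h2 : i = j <;>
      simp [h1, h2]
  intro h0
  have := congrArg det h
  rw [det_mul, h0, zero_mul, det_smul, det_one, mul_one] at this
  exact pow_ne_zero _ (Nat.cast_ne_zero.mpr (NeZero.ne n)) this.symm

/-- The blocks of the Fourier transform of the Laplacian of a foliation plus the matrix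
with all entries `1`. -/
noncomputable def fourierBlock (n : ℕ) [NeZero n] (s : α → Finset ℕ) (x y : ι → α) (j : ZMod n) :
    Matrix α α ℂ :=
  edgeLaplacian ℂ x y + diagonal (fun i => circulantEigenvalue n (s i) j) +
    Matrix.of fun _ _ => if j = 0 then (n : ℂ) else 0

/-- The all-ones matrix sees only the trivial character, so it contributes to the block `j = 0`
alone. -/
theorem edgeLaplacian_foliation_mul_fourierMatrix :
    (edgeLaplacian ℂ (foliationEdgeFst n s x) (foliationEdgeSnd n s y) +
      Matrix.of fun _ _ => 1) * fourierMatrix n α =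
    fourierMatrix n α * (blockDiagonal (fourierBlock n s x y)).submatrix Prod.swap Prod.swap := by
  ext ⟨k, i⟩ ⟨j, b⟩
  have h1 : (edgeLaplacian ℂ (foliationEdgeFst n s x) (foliationEdgeSnd n s y) *
      fourierMatrix n α) (k, i) (j, b) = ZMod.stdAddChar (k * j) * (edgeLaplacian ℂ x y +
      diagonal fun i => circulantEigenvalue n (s i) j) i b := by
    have := edgeLaplacian_foliation_mulVec (s := s) (x := x) (y := y) j (Pi.single b 1) k i
    rw [mulVec_single_one] at this
    exact this
  have h2 : ((Matrix.of fun _ _ => 1 : Matrix (ZMod n × α) (ZMod n × α) ℂ) *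
      fourierMatrix n α) (k, i) (j, b) = if j = 0 then (n : ℂ) else 0 := by
    have hs := AddChar.sum_mulShift j (ZMod.isPrimitive_stdAddChar n)
    rw [ZMod.card, Nat.cast_ite, Nat.cast_zero] at hs
    rw [mul_apply, Fintype.sum_prod_type, ← hs]
    refine Finset.sum_congr rfl fun c _ => ?_
    simp [fourierMatrix, ← Finset.mul_sum]
  have h3 : (fourierMatrix n α * (blockDiagonal (fourierBlock n s x y)).submatrix
      Prod.swap Prod.swap) (k, i) (j, b) = ZMod.stdAddChar (k * j) * fourierBlock n s x y j i b := by
    rw [mul_apply, Fintype.sum_prod_type, Finset.sum_eq_single j, Finset.sum_eq_single i]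
    · simp [fourierMatrix, blockDiagonal_apply]
    · intro a _ ha
      simp [fourierMatrix, Pi.single_apply, ha.symm]
    · simp
    · intro c _ hc
      simp [blockDiagonal_apply, hc]
    · simp
  rw [add_mul, Matrix.add_apply, h1, h2, h3, fourierBlock, Matrix.add_apply, mul_add]
  by_cases hj : j = 0
  · simp [hj]
  · simp [hj, mul_add]

theorem det_edgeLaplacian_foliation_add_one :
    (edgeLaplacian ℂ (foliationEdgeFst n s x) (foliationEdgeSnd n s y) +
      Matrix.of fun _ _ => 1).det = ∏ j, (fourierBlock n s x y j).det := by
  have h := congrArg det (edgeLaplacian_foliation_mul_fourierMatrix (n := n) (s := s) (x := x)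
    (y := y))
  rw [det_mul, det_mul, mul_comm] at h
  rw [mul_left_cancel₀ det_fourierMatrix_ne_zero h, ← det_blockDiagonal]
  exact det_submatrix_equiv_self (Equiv.prodComm (ZMod n) α) _

/-- Two evaluations of det(L_n + J): (nm)² τ(n) by `det_add_const`, and by blocks, where the block
at 0 gives n m² τ(H). The common factor n m² cancels. -/
theorem IsEdgeEnumeration.numSpanningTrees_foliation [Nonempty α]
    (h : IsEdgeEnumeration H en x y) :
    (n : ℂ) * numSpanningTrees (CirculantFoliation.foliation n H s) = numSpanningTrees H *
      ∏ j ∈ Finset.univ.erase (0 : ZMod n),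
        (edgeLaplacian ℂ x y + diagonal (fun i => circulantEigenvalue n (s i) j)).det := by
  have h1 := h.foliation (n := n) (s := s) |>.det_add_const (1 : ℂ)
  rw [det_edgeLaplacian_foliation_add_one, ← Finset.mul_prod_erase _ _ (Finset.mem_univ 0)] at h1
  have h2 : fourierBlock n s x y 0 = edgeLaplacian ℂ x y + Matrix.of fun _ _ => (n : ℂ) := by
    ext i b
    norm_num [fourierBlock, circulantEigenvalue]
  rw [h2, h.det_add_const, Finset.prod_congr rfl fun j hj => show (fourierBlock n s x y j).det =
    (edgeLaplacian ℂ x y + diagonal (fun i => circulantEigenvalue n (s i) j)).det by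
      have : (Matrix.of fun _ _ => 0 : Matrix α α ℂ) = 0 := rfl
      rw [fourierBlock]; simp [Finset.ne_of_mem_erase hj, this]] at h1
  rw [Fintype.card_prod, ZMod.card, Nat.cast_mul] at h1
  have hn : (n : ℂ) ≠ 0 := Nat.cast_ne_zero.mpr (NeZero.ne n)
  have hc : (Fintype.card α : ℂ) ≠ 0 := Nat.cast_ne_zero.mpr Fintype.card_ne_zero
  apply mul_left_cancel₀ (mul_ne_zero hn (pow_ne_zero 2 hc))
  linear_combination -h1

end Fourier

open Polynomial

/-! ### Determinants of polynomial matrices -/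

section PolynomialMatrix

variable {R m : Type*} [CommRing R] [Fintype m] [DecidableEq m]

theorem derivative_det (M : Matrix m m R[X]) :
    derivative M.det = ∑ i, (M.updateCol i fun j => derivative (M j i)).det := by
  simp only [det_apply', derivative_sum]
  rw [Finset.sum_comm]
  refine Finset.sum_congr rfl fun σ _ => ?_
  rw [derivative_mul, derivative_intCast, zero_mul, zero_add, derivative_prod_finset, Finset.mul_sum]
  refine Finset.sum_congr rfl fun i _ => ?_
  rw [← Finset.prod_erase_mul _ _ (Finset.mem_univ i), updateCol_self]
  congr 2
  exact Finset.prod_congr rfl fun j hj => by rw [updateCol_ne (Finset.ne_of_mem_erase hj)]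

theorem coeff_prod_sum_of_natDegree_le {ι : Type*} (t : Finset ι) (p : ι → R[X]) (d : ι → ℕ)
    (h : ∀ i ∈ t, (p i).natDegree ≤ d i) :
    (∏ i ∈ t, p i).natDegree ≤ ∑ i ∈ t, d i ∧
      (∏ i ∈ t, p i).coeff (∑ i ∈ t, d i) = ∏ i ∈ t, (p i).coeff (d i) := by
  classical
  induction t using Finset.induction_on with
  | empty => simp
  | insert a t ha ih =>
    obtain ⟨h1, h2⟩ := ih fun i hi => h i (Finset.mem_insert_of_mem hi)
    have h3 := h a (Finset.mem_insert_self a t)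
    rw [Finset.prod_insert ha, Finset.sum_insert ha, Finset.prod_insert ha,
      coeff_mul_add_eq_of_natDegree_le h3 h1, h2]
    exact ⟨natDegree_mul_le_of_le h3 h1, rfl⟩

theorem coeff_det_of_natDegree_le (M : Matrix m m R[X]) (d : m → ℕ)
    (h : ∀ i j, (M i j).natDegree ≤ d i) :
    M.det.natDegree ≤ ∑ i, d i ∧
      M.det.coeff (∑ i, d i) = (Matrix.of fun i j => (M i j).coeff (d i)).det := by
  have key : ∀ σ : Equiv.Perm m, (∏ i, M (σ i) i).natDegree ≤ ∑ i, d i ∧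
      (∏ i, M (σ i) i).coeff (∑ i, d i) = ∏ i, (M (σ i) i).coeff (d (σ i)) := by
    intro σ
    rw [← Equiv.sum_comp σ d]
    exact coeff_prod_sum_of_natDegree_le Finset.univ (fun i => M (σ i) i) (fun i => d (σ i))
      fun i _ => h _ _
  constructor
  · rw [det_apply']
    refine natDegree_sum_le_of_forall_le _ _ fun σ _ => ?_
    refine natDegree_mul_le_of_le (m := 0) (natDegree_intCast _).le (key σ).1 |>.trans ?_
    simp
  · simp only [det_apply', finsetSum_coeff]
    refine Finset.sum_congr rfl fun σ _ => ?_
    rw [← Polynomial.C_eq_intCast, coeff_C_mul, (key σ).2]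
    simp

end PolynomialMatrix

/-! ### Rescaled Chebyshev polynomials -/

section Chebyshev

/-- Two consecutive degrees are carried along for the two-step recursion. Monicity starts at index
1, since C_0 = 2. -/
theorem natDegree_chebyshevC_le (a : ℕ) : (Chebyshev.C ℤ a).natDegree ≤ a ∧
    (Chebyshev.C ℤ (a + 1 : ℕ)).natDegree ≤ a + 1 ∧ (Chebyshev.C ℤ (a + 1 : ℕ)).coeff (a + 1) = 1 := by
  induction a with
  | zero =>
    refine ⟨?_, ?_, ?_⟩
    · rw [Nat.cast_zero, Chebyshev.C_zero]; exact (natDegree_ofNat 2).le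
    · simp
    · simp
  | succ a ih =>
    obtain ⟨h1, h2, h3⟩ := ih
    have e : Chebyshev.C ℤ ((a + 1 + 1 : ℕ) : ℤ) =
        X * Chebyshev.C ℤ ((a + 1 : ℕ) : ℤ) - Chebyshev.C ℤ (a : ℤ) := by
      have := Chebyshev.C_add_two ℤ a
      push_cast at this ⊢
      rw [← this]
      congr 1
    refine ⟨h2, ?_, ?_⟩
    · rw [e]
      refine natDegree_sub_le_of_le (natDegree_mul_le_of_le natDegree_X_le h2) h1 |>.trans ?_
      omega
    · rw [e, coeff_sub, coeff_X_mul, h3, coeff_eq_zero_of_natDegree_lt (by omega), sub_zero]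

theorem coeff_two_of_ne_zero {k : ℕ} (hk : k ≠ 0) : (2 : ℤ[X]).coeff k = 0 := by
  obtain ⟨k, rfl⟩ := Nat.exists_eq_succ_of_ne_zero hk
  exact coeff_ofNat_succ 2 k

/-- Chain rule in C_a(2w) = 2 T_a(w) at w = 1, with T_a'(1) = a². -/
theorem derivative_chebyshevC_eval_two (a : ℤ) :
    (derivative (Chebyshev.C ℤ a)).eval 2 = a ^ 2 := by
  have h := congrArg (fun p => (derivative p).eval 1) (Chebyshev.C_comp_two_mul_X ℤ a)
  simp only [derivative_comp, eval_mul, eval_comp] at h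
  simp [Chebyshev.derivative_T_eval_one] at h
  linarith

theorem chebyshevC_eval_add {R : Type*} [CommRing R] (z w : R) (h : z * w = 1) (a : ℕ) :
    (Chebyshev.C R a).eval (z + w) = z ^ a + w ^ a := by
  rw [← dickson_one_one_eq_chebyshev_C, dickson_one_one_eval_add_inv _ _ h]

/-- The contribution `∑_{a ∈ S} (2 - C_a)` of a fibre with set of jumps `S` to the Chebyshev
transform, in the variable `2 w`. -/
noncomputable def jumpPoly (S : Finset ℕ) : ℤ[X] :=
  ∑ a ∈ S, (2 - Chebyshev.C ℤ a)

theorem jumpPoly_eval_two (S : Finset ℕ) : (jumpPoly S).eval 2 = 0 := by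
  simp [jumpPoly, eval_finsetSum]

theorem derivative_jumpPoly_eval_two (S : Finset ℕ) :
    (derivative (jumpPoly S)).eval 2 = -∑ a ∈ S, (a : ℤ) ^ 2 := by
  simp [jumpPoly, eval_finsetSum, derivative_chebyshevC_eval_two]

theorem natDegree_jumpPoly_le (S : Finset ℕ) : (jumpPoly S).natDegree ≤ S.sup id := by
  refine natDegree_sum_le_of_forall_le _ _ fun a ha => ?_
  refine natDegree_sub_le_of_le (n := S.sup id) (m := S.sup id) ?_ ?_ |>.trans (max_self _).le
  · exact (natDegree_ofNat 2).le.trans (Nat.zero_le _)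
  · exact (natDegree_chebyshevC_le a).1.trans (Finset.le_sup (f := id) ha)

theorem coeff_jumpPoly {S : Finset ℕ} (hS : S.Nonempty) (h1 : ∀ a ∈ S, 1 ≤ a) :
    (jumpPoly S).coeff (S.sup id) = -1 := by
  obtain ⟨b, hb, hb'⟩ := Finset.exists_mem_eq_sup S hS id
  rw [hb', jumpPoly, finsetSum_coeff, Finset.sum_eq_single b]
  · obtain ⟨c, rfl⟩ := Nat.exists_eq_add_of_le' (h1 b hb)
    rw [coeff_sub, id, (natDegree_chebyshevC_le c).2.2, coeff_two_of_ne_zero (by omega), zero_sub]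
  · intro a ha hab
    have h2 : a < b := lt_of_le_of_ne ((Finset.le_sup (f := id) ha).trans hb'.le) hab
    rw [coeff_sub, id, coeff_eq_zero_of_natDegree_lt ((natDegree_chebyshevC_le a).1.trans_lt h2),
      coeff_two_of_ne_zero (by omega), sub_zero]
  · exact fun h => absurd hb h

end Chebyshev

/-! ### The Chebyshev transform in the variable `2 w` -/

section Transform

variable {α β ι : Type*} {H : Graph α β} {en : ι → β} {x y : ι → α} {n : ℕ} {s : α → Finset ℕ}
  [Fintype α] [DecidableEq α]

/-- The polynomial whose value at `2 w` is the Chebyshev transform. -/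
noncomputable def rescaledTransform (H : Graph α β) (s : α → Finset ℕ) : ℤ[X] :=
  (genLaplacian H fun i => (degree H i : ℤ[X]) + jumpPoly (s i)).det

theorem chebyshevTransform_eq_comp :
    chebyshevTransform H s = (rescaledTransform H s).comp (2 * X) := by
  rw [chebyshevTransform, rescaledTransform, ← coe_compRingHom_apply, RingHom.map_det]
  congr 1
  ext1 i j
  by_cases h : i = j
  · subst h
    simp [genLaplacian, jumpPoly, Chebyshev.C_comp_two_mul_X, sum_comp]
    ring
  · simp [genLaplacian, h]

variable [Fintype ι]

theorem IsEdgeEnumeration.rescaledTransform_eq (h : IsEdgeEnumeration H en x y) :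
    rescaledTransform H s =
      (edgeLaplacian ℤ[X] x y + diagonal fun i => jumpPoly (s i)).det := by
  rw [rescaledTransform, h.genLaplacian_eq]

theorem IsEdgeEnumeration.aeval_rescaledTransform [NeZero n] (h : IsEdgeEnumeration H en x y)
    (j : ZMod n) :
    aeval (ZMod.stdAddChar j + ZMod.stdAddChar (-j) : ℂ) (rescaledTransform H s) =
      (edgeLaplacian ℂ x y + diagonal fun i => circulantEigenvalue n (s i) j).det := by
  have hj : (ZMod.stdAddChar j * ZMod.stdAddChar (-j) : ℂ) = 1 := by
    rw [← AddChar.map_add_eq_mul, add_neg_cancel, AddChar.map_zero_eq_one]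
  rw [h.rescaledTransform_eq, ← AlgHom.coe_toRingHom, RingHom.map_det, RingHom.mapMatrix_apply,
    Matrix.map_add _ (map_add _), edgeLaplacian_map, diagonal_map (map_zero _)]
  congr 3
  ext i
  simp only [jumpPoly, circulantEigenvalue, AlgHom.coe_toRingHom, map_sum, map_sub,
    Chebyshev.aeval_C, map_ofNat]
  refine Finset.sum_congr rfl fun a _ => ?_
  rw [chebyshevC_eval_add _ _ hj, ← AddChar.map_nsmul_eq_pow, ← AddChar.map_nsmul_eq_pow]
  simp only [nsmul_eq_mul, mul_neg]
  ring

theorem IsEdgeEnumeration.rescaledTransform_eval_two [Nonempty α]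
    (h : IsEdgeEnumeration H en x y) : (rescaledTransform H s).eval 2 = 0 := by
  rw [h.rescaledTransform_eq, ← coe_evalRingHom, RingHom.map_det, RingHom.mapMatrix_apply,
    Matrix.map_add _ (map_add _), edgeLaplacian_map, diagonal_map (map_zero _)]
  simp [jumpPoly_eval_two, det_edgeLaplacian]

/-- Differentiate column by column. At 2 all jump polynomials vanish, so differentiating column i
leaves -∑ a² times a principal cofactor of the Laplacian, which is τ(H). This is where q comes from.
-/
theorem IsEdgeEnumeration.derivative_rescaledTransform_eval_two
    (h : IsEdgeEnumeration H en x y) : (derivative (rescaledTransform H s)).eval 2 =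
      -((∑ i, ∑ a ∈ s i, (a : ℤ) ^ 2) * numSpanningTrees H) := by
  rw [h.rescaledTransform_eq, derivative_det, eval_finsetSum, Finset.sum_mul,
    ← Finset.sum_neg_distrib]
  refine Finset.sum_congr rfl fun i _ => ?_
  have h1 : (fun j => derivative ((edgeLaplacian ℤ[X] x y +
      diagonal fun i => jumpPoly (s i)) j i)) = Pi.single i (derivative (jumpPoly (s i))) := by
    ext1 j
    have h2 : derivative (edgeLaplacian ℤ[X] x y j i) = 0 := by
      rw [← edgeLaplacian_map (Polynomial.C : ℤ →+* ℤ[X]), map_apply, derivative_C]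
    by_cases hj : j = i
    · subst hj; simp [h2]
    · simp [h2, hj]
  rw [h1, ← coe_evalRingHom, RingHom.map_det, RingHom.mapMatrix_apply, map_updateCol,
    Matrix.map_add _ (map_add _), edgeLaplacian_map, diagonal_map (map_zero _)]
  have h3 : (evalRingHom (2 : ℤ) ∘ Pi.single i (derivative (jumpPoly (s i)))) =
      (-∑ a ∈ s i, (a : ℤ) ^ 2) • Pi.single i 1 := by
    ext j
    by_cases hj : j = i
    · subst hj; simp [derivative_jumpPoly_eval_two]
    · simp [hj]
  have h4 : (fun i => evalRingHom (2 : ℤ) (jumpPoly (s i))) = 0 := by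
    ext j
    simp [jumpPoly_eval_two]
  rw [h3, det_updateCol_smul, h4, diagonal_zero', add_zero, h.det_updateCol, neg_mul]

theorem IsEdgeEnumeration.laplacian_eq (h : IsEdgeEnumeration H en x y) :
    laplacian H = edgeLaplacian ℤ x y := by
  have := h.genLaplacian_eq (0 : α → ℤ)
  simpa [laplacian] using this

/-- Take top coefficients row by row. A row with nonempty fibre becomes -1 on the diagonal and 0
elsewhere; a row with empty fibre stays a Laplacian row. The resulting matrix is block triangular.
-/
theorem IsEdgeEnumeration.coeff_rescaledTransform (h : IsEdgeEnumeration H en x y)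
    (hs : ∀ i, ∀ a ∈ s i, 1 ≤ a) :
    (rescaledTransform H s).natDegree ≤ ∑ i, (s i).sup id ∧
      ∃ k : ℕ, (rescaledTransform H s).coeff (∑ i, (s i).sup id) =
        (-1) ^ k * emptyFibreMinor H s := by
  have hL : ∀ i j, edgeLaplacian ℤ[X] x y i j = Polynomial.C (edgeLaplacian ℤ x y i j) := by
    intro i j
    rw [← edgeLaplacian_map (Polynomial.C : ℤ →+* ℤ[X]), map_apply]
  rw [h.rescaledTransform_eq]
  obtain ⟨h1, h2⟩ := coeff_det_of_natDegree_le
    (edgeLaplacian ℤ[X] x y + diagonal fun i => jumpPoly (s i)) (fun i => (s i).sup id) (by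
      intro i j
      rw [Matrix.add_apply, hL]
      refine natDegree_add_le_of_le (natDegree_C _).le ?_ |>.trans
        (max_le (Nat.zero_le ((s i).sup id)) le_rfl)
      by_cases hij : i = j
      · subst hij; simpa using natDegree_jumpPoly_le (s i)
      · simp [hij])
  refine ⟨h1, Fintype.card {i // ¬ s i = ∅}, ?_⟩
  have hpos : ∀ i, s i ≠ ∅ → (s i).sup id ≠ 0 := by
    intro i hi
    obtain ⟨a, ha⟩ := Finset.nonempty_iff_ne_empty.mpr hi
    have := Finset.le_sup (f := id) ha
    have := hs i a ha
    simp only [id] at *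
    omega
  have hrow : ∀ i, s i ≠ ∅ → ∀ j, ((edgeLaplacian ℤ[X] x y + diagonal fun i => jumpPoly (s i))
      i j).coeff ((s i).sup id) = if i = j then -1 else 0 := by
    intro i hi j
    rw [Matrix.add_apply, hL, coeff_add, coeff_C_of_ne_zero (hpos i hi), zero_add]
    by_cases hij : i = j
    · subst hij
      simp [coeff_jumpPoly (Finset.nonempty_iff_ne_empty.mpr hi) (hs i)]
    · simp [hij]
  rw [h2, twoBlockTriangular_det _ (fun i => s i = ∅), mul_comm]
  · congr 1
    · have : toSquareBlockProp (Matrix.of fun i j => ((edgeLaplacian ℤ[X] x y +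
          diagonal fun i => jumpPoly (s i)) i j).coeff ((s i).sup id)) (fun i => ¬ s i = ∅) =
          diagonal fun _ => -1 := by
        ext i j
        rw [toSquareBlockProp_def, of_apply, of_apply, hrow i.1 i.2, diagonal_apply]
        simp [Subtype.ext_iff]
      rw [this, det_diagonal]
      simp
    · rw [emptyFibreMinor, h.laplacian_eq]
      congr 1
      ext i j
      rw [toSquareBlockProp_def, of_apply, of_apply, Matrix.add_apply, hL, i.2]
      by_cases hij : i = j
      · subst hij; simp [i.2, jumpPoly]
      · have : i.1 ≠ j.1 := fun h => hij (Subtype.ext h)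
        simp [this]
  · intro i hi j hj
    rw [of_apply, hrow i hi, if_neg]
    rintro rfl
    exact hi hj

end Transform

/-! ### Positivity for connected graphs -/

section Positivity

variable {α β ι : Type*} {H : Graph α β} {en : ι → β} {x y : ι → α} {s : α → Finset ℕ}

theorem IsEdgeEnumeration.edgeConnected_univ (h : IsEdgeEnumeration H en x y)
    (hH : IsConnected H) : EdgeConnected x y Set.univ := by
  intro u v
  refine Relation.ReflTransGen.mono (fun a b hab => ?_) u v
    (hH.2 u (h.vertexSet_eq ▸ Set.mem_univ u) v (h.vertexSet_eq ▸ Set.mem_univ v))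
  obtain ⟨e, he⟩ := hab
  obtain ⟨i, rfl⟩ := h.exists_eq e he.edge_mem
  exact ⟨i, Set.mem_univ i, (h.isLink_iff i a b).mp he⟩

variable [Fintype α] [DecidableEq α] [Fintype ι]

theorem IsEdgeEnumeration.numSpanningTrees_ne_zero (h : IsEdgeEnumeration H en x y)
    (hH : IsConnected H) : numSpanningTrees H ≠ 0 := by
  obtain ⟨r, -⟩ := hH.1
  have : Nonempty α := ⟨r⟩
  obtain ⟨f, -, hf⟩ := (h.edgeConnected_univ hH).exists_det_ne_zero (r := r)
  obtain ⟨S, hS, -⟩ := det_ne_zero_iff_isTreeSet.mp hf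
  rw [h.numSpanningTrees_eq]
  exact Set.ncard_ne_zero_of_mem hS

/-- The minor belongs to the form ∑ (f(x) - f(y))² over the edges, restricted to functions vanishing
where the fibre is nonempty. A null vector is constant by connectedness, and zero at `i₀`. -/
theorem IsEdgeEnumeration.emptyFibreMinor_pos (h : IsEdgeEnumeration H en x y)
    (hH : IsConnected H) (hs : ∃ i, (s i).Nonempty) : 0 < emptyFibreMinor H s := by
  obtain ⟨i₀, hi₀⟩ := hs
  let p : α → Prop := fun i => s i = ∅
  have hpd : ((edgeLaplacian ℝ x y).submatrix (Subtype.val : {i // p i} → α)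
      Subtype.val).PosDef := by
    refine Matrix.PosDef.of_dotProduct_mulVec_pos ?_ fun z hz => ?_
    · refine Matrix.IsHermitian.submatrix ?_ _
      rw [Matrix.IsHermitian, conjTranspose_eq_transpose_of_trivial, edgeLaplacian_transpose]
    · let f : α → ℝ := fun i => if hi : p i then z ⟨i, hi⟩ else 0
      have hf : ∀ i : {i // p i}, f i = z i := fun i => by simp [f, i.2]
      have hsum : ∀ g : α → ℝ, ∑ i, g i * f i = ∑ i : {i // p i}, g i * z i := by
        intro g
        rw [← Fintype.sum_subtype_add_sum_subtype p, add_eq_left.mpr]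
        · exact Finset.sum_congr rfl fun i _ => by rw [hf]
        · exact Finset.sum_eq_zero fun i _ => by simp [f, i.2]
      have hquad : star z ⬝ᵥ ((edgeLaplacian ℝ x y).submatrix (Subtype.val : {i // p i} → α)
          Subtype.val *ᵥ z) = ∑ i, (f (x i) - f (y i)) ^ 2 := by
        rw [← edgeLaplacian_quadratic, dotProduct_comm f]
        simp only [dotProduct, hsum, mulVec, submatrix_apply, star_trivial]
        exact Finset.sum_congr rfl fun i _ => mul_comm _ _
      rw [hquad]
      refine lt_of_le_of_ne (Finset.sum_nonneg fun i _ => sq_nonneg _) fun h0 => hz ?_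
      have hzero := (Finset.sum_eq_zero_iff_of_nonneg fun i _ => sq_nonneg _).mp h0.symm
      have hconst := (h.edgeConnected_univ hH).eq_of_forall_eq f fun i _ =>
        sub_eq_zero.mp (pow_eq_zero_iff two_ne_zero |>.mp (hzero i (Finset.mem_univ i)))
      ext i
      have hi₀' : ¬ p i₀ := hi₀.ne_empty
      rw [← hf, hconst i i₀]
      simp [f, hi₀']
  have hdet := hpd.det_pos
  have hcast : ((emptyFibreMinor H s : ℤ) : ℝ) = ((edgeLaplacian ℝ x y).submatrix
      (Subtype.val : {i // p i} → α) Subtype.val).det := by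
    rw [emptyFibreMinor, h.laplacian_eq, ← edgeLaplacian_map (Int.castRingHom ℝ), ← eq_intCast
      (Int.castRingHom ℝ), RingHom.map_det]
    rfl
  rw [← hcast] at hdet
  exact_mod_cast hdet

end Positivity

/-! ### Products over roots of unity -/

section RootsOfUnity

variable {n : ℕ} [NeZero n]

theorem prod_X_sub_stdAddChar :
    ∏ j : ZMod n, (X - Polynomial.C (ZMod.stdAddChar j : ℂ)) = X ^ n - 1 := by
  classical
  have hsub : Finset.univ.image (fun j : ZMod n => (ZMod.stdAddChar j : ℂ)) ⊆
      nthRootsFinset n (1 : ℂ) := by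
    intro z hz
    obtain ⟨j, -, rfl⟩ := Finset.mem_image.mp hz
    rw [mem_nthRootsFinset (NeZero.pos n), ← AddChar.map_nsmul_eq_pow]
    simp
  have hcard : (Finset.univ.image (fun j : ZMod n => (ZMod.stdAddChar j : ℂ))).card = n := by
    rw [Finset.card_image_of_injective _ (ZMod.injective_stdAddChar), Finset.card_univ, ZMod.card]
  have heq := Finset.eq_of_subset_of_card_le hsub (by
    rw [hcard, (Complex.isPrimitiveRoot_exp n (NeZero.ne n)).card_nthRootsFinset])
  rw [X_pow_sub_one_eq_prod (NeZero.pos n) (Complex.isPrimitiveRoot_exp n (NeZero.ne n)), ← heq,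
    Finset.prod_image fun a _ b _ h => ZMod.injective_stdAddChar h]

theorem prod_sub_stdAddChar (z : ℂ) : ∏ j : ZMod n, (z - ZMod.stdAddChar j) = z ^ n - 1 := by
  simpa [eval_prod] using congrArg (eval z) (prod_X_sub_stdAddChar (n := n))

theorem prod_erase_zero_one_sub_stdAddChar :
    ∏ j ∈ Finset.univ.erase (0 : ZMod n), (1 - ZMod.stdAddChar j : ℂ) = n := by
  have h := prod_X_sub_stdAddChar (n := n)
  rw [← Finset.mul_prod_erase _ _ (Finset.mem_univ 0), AddChar.map_zero_eq_one, map_one,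
    ← mul_geom_sum] at h
  have := congrArg (eval 1) (mul_left_cancel₀ (X_sub_C_ne_zero (1 : ℂ)) h)
  simpa [eval_prod, eval_finsetSum] using this

theorem stdAddChar_mul_neg (j : ZMod n) :
    (ZMod.stdAddChar j * ZMod.stdAddChar (-j) : ℂ) = 1 := by
  rw [← AddChar.map_add_eq_mul, add_neg_cancel, AddChar.map_zero_eq_one]

theorem prod_erase_zero_two_sub :
    ∏ j ∈ Finset.univ.erase (0 : ZMod n), (2 - (ZMod.stdAddChar j + ZMod.stdAddChar (-j)) : ℂ) =
      (n : ℂ) ^ 2 := by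
  have h : ∏ j ∈ Finset.univ.erase (0 : ZMod n), (1 - ZMod.stdAddChar (-j) : ℂ) = n := by
    rw [← prod_erase_zero_one_sub_stdAddChar (n := n)]
    exact Finset.prod_equiv (Equiv.neg _) (by simp) (by simp)
  rw [sq]
  nth_rw 1 [← prod_erase_zero_one_sub_stdAddChar (n := n)]
  rw [← h, ← Finset.prod_mul_distrib]
  refine Finset.prod_congr rfl fun j _ => ?_
  linear_combination -stdAddChar_mul_neg j

/-- With 2w = z + z' and zz' = 1, each factor is z'(z - ζ)(z - ζ⁻¹) for an n-th root of unity ζ. The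
product is z'ⁿ(zⁿ - 1)² = zⁿ + z'ⁿ - 2. -/
theorem prod_two_mul_sub (w : ℂ) :
    ∏ j : ZMod n, (2 * w - (ZMod.stdAddChar j + ZMod.stdAddChar (-j)) : ℂ) =
      2 * (Chebyshev.T ℂ (n : ℤ)).eval w - 2 := by
  -- w ± r are the roots of z² - 2wz + 1.
  obtain ⟨r, hr⟩ := IsAlgClosed.exists_pow_nat_eq (w ^ 2 - 1) (n := 2) (by norm_num)
  set z := w + r with hz
  set z' := w - r with hz'
  have hzz : z * z' = 1 := by rw [hz, hz']; linear_combination -hr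
  have hT : 2 * (Chebyshev.T ℂ (n : ℤ)).eval w = z ^ n + z' ^ n := by
    have h := congrArg (eval w) (Chebyshev.C_comp_two_mul_X ℂ (n : ℤ))
    rw [eval_comp, eval_mul, eval_mul, eval_X, eval_ofNat] at h
    rw [← h, ← chebyshevC_eval_add _ _ hzz]
    congr 1
    rw [hz, hz']; ring
  have h : ∏ j : ZMod n, (z - ZMod.stdAddChar (-j) : ℂ) = z ^ n - 1 := by
    rw [← prod_sub_stdAddChar (n := n)]
    exact Fintype.prod_equiv (Equiv.neg _) _ _ (by simp)
  have e : ∀ j : ZMod n, (2 * w - (ZMod.stdAddChar j + ZMod.stdAddChar (-j)) : ℂ) =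
      z' * ((z - ZMod.stdAddChar j) * (z - ZMod.stdAddChar (-j))) := by
    intro j
    have hw : 2 * w = z + z' := by rw [hz, hz']; ring
    rw [hw]
    linear_combination (-z + (ZMod.stdAddChar j + ZMod.stdAddChar (-j)) : ℂ) * hzz -
      z' * stdAddChar_mul_neg j
  rw [Finset.prod_congr rfl fun j _ => e j, Finset.prod_mul_distrib, Finset.prod_mul_distrib, h,
    prod_sub_stdAddChar, hT, Finset.prod_const, Finset.card_univ, ZMod.card]
  have hzn : z ^ n * z' ^ n = 1 := by rw [← mul_pow, hzz, one_pow]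
  linear_combination (z ^ n - 2) * hzn

theorem isIntegral_aeval_stdAddChar (p : ℤ[X]) (j : ZMod n) :
    IsIntegral ℤ (aeval (ZMod.stdAddChar j + ZMod.stdAddChar (-j) : ℂ) p) := by
  have h : ∀ j : ZMod n, IsIntegral ℤ (ZMod.stdAddChar j : ℂ) := by
    intro j
    refine IsIntegral.of_pow (NeZero.pos n) ?_
    rw [← AddChar.map_nsmul_eq_pow]
    simp [isIntegral_one]
  let t : integralClosure ℤ ℂ := ⟨_, (h j).add (h (-j))⟩
  have := (aeval t p).2
  rwa [← Subalgebra.aeval_coe] at this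

end RootsOfUnity

/-! ### Roots of the cofactor R of 2 - X -/

section Roots

variable {α β : Type*} [Fintype α] [DecidableEq α] {H : Graph α β} {s : α → Finset ℕ} {R : ℤ[X]}

/-- Q(w) = 2(1 - w) R(2w) and R(2) ≠ 0, so discarding the root 1 removes exactly the linear factor.
-/
theorem rootsNeOne_eq_roots (hR : rescaledTransform H s = (2 - X) * R) (hR2 : R.eval 2 ≠ 0) :
    rootsNeOne H s = ((R.map (Int.castRingHom ℂ)).comp (2 * X)).roots := by
  set U := (R.map (Int.castRingHom ℂ)).comp (2 * X) with hU
  have hU1 : U.eval 1 ≠ 0 := by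
    have : U.eval 1 = ((R.eval 2 : ℤ) : ℂ) := by
      rw [hU, eval_comp, eval_mul, eval_X, eval_ofNat, mul_one,
        ← map_ofNat (Int.castRingHom ℂ) 2, eval_map_apply, eq_intCast]
    rw [this]
    exact_mod_cast hR2
  have hU0 : U ≠ 0 := fun h0 => hU1 (by rw [h0, eval_zero])
  have hmap : (chebyshevTransform H s).map (algebraMap ℤ ℂ) =
      Polynomial.C (-2) * (X - Polynomial.C 1) * U := by
    rw [chebyshevTransform_eq_comp, hR, Polynomial.map_comp]
    simp only [Polynomial.map_mul, Polynomial.map_sub, Polynomial.map_ofNat, map_X, mul_comp,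
      sub_comp, ofNat_comp, X_comp, map_neg, map_ofNat, map_one]
    rw [hU]
    simp only [algebraMap_int_eq]
    ring
  have hlin : (Polynomial.C (-2) * (X - Polynomial.C 1) : ℂ[X]) ≠ 0 :=
    mul_ne_zero (C_ne_zero.mpr (by norm_num)) (X_sub_C_ne_zero 1)
  rw [rootsNeOne, aroots_def, hmap, roots_mul (mul_ne_zero hlin hU0),
    roots_C_mul _ (by norm_num), roots_X_sub_C, Multiset.filter_add, Multiset.filter_singleton,
    if_neg (by simp), Multiset.filter_eq_self.mpr]
  · simp
  · rintro w hw rfl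
    exact hU1 (isRoot_of_mem_roots hw)

theorem aeval_eq_prod_rootsNeOne (hR : rescaledTransform H s = (2 - X) * R) (hR2 : R.eval 2 ≠ 0) (t : ℂ) :
    aeval t R = R.leadingCoeff * ((rootsNeOne H s).map fun w => t - 2 * w).prod := by
  have h2X : (2 * X : ℂ[X]) = Polynomial.C 2 * X := by rw [map_ofNat]
  have h1 := (IsAlgClosed.splits ((R.map (Int.castRingHom ℂ)).comp (2 * X))).eval_eq_prod_roots
    (t / 2)
  have hcard : ((R.map (Int.castRingHom ℂ)).comp (2 * X)).roots.card =
      (R.map (Int.castRingHom ℂ)).natDegree := by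
    rw [IsAlgClosed.card_roots_eq_natDegree, natDegree_comp, h2X,
      natDegree_C_mul_X _ (by norm_num), mul_one]
  have h2 : (2 * X : ℂ[X]).natDegree ≠ 0 := by
    rw [h2X, natDegree_C_mul_X _ (by norm_num)]; exact one_ne_zero
  have h3 : (2 * X : ℂ[X]).leadingCoeff = 2 := by
    rw [h2X, leadingCoeff_mul, leadingCoeff_C, leadingCoeff_X, mul_one]
  -- R(2X) has one factor 2 per root in its leading coefficient; each is absorbed into t/2 - w.
  rw [eval_comp, eval_mul, eval_X, eval_ofNat, mul_div_cancel₀ _ two_ne_zero,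
    leadingCoeff_comp h2, h3, ← hcard, leadingCoeff_map_of_injective (RingHom.injective_int _),
    mul_assoc, ← Multiset.prod_replicate, ← Multiset.map_const', ← Multiset.prod_map_mul,
    ← rootsNeOne_eq_roots hR hR2] at h1
  rw [aeval_def, ← eval_map, algebraMap_int_eq, h1, eq_intCast]
  congr 3
  ext w
  ring

end Roots

/-! ### Divisibility and the closed formula -/

section Formula

variable {α β ι : Type*} {H : Graph α β} {en : ι → β} {x y : ι → α} {n : ℕ} {s : α → Finset ℕ}
  [Fintype α] [DecidableEq α] [Fintype ι]

/-- The Chebyshev transform, in the variable `2 w`, is divisible by `2 - 2 w`. -/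
theorem IsEdgeEnumeration.exists_rescaledTransform_eq_mul [Nonempty α]
    (h : IsEdgeEnumeration H en x y) : ∃ R : ℤ[X], rescaledTransform H s = (2 - X) * R ∧
      R.eval 2 = (∑ i, ∑ a ∈ s i, (a : ℤ) ^ 2) * numSpanningTrees H := by
  obtain ⟨R, hR⟩ := dvd_iff_isRoot.mpr (h.rescaledTransform_eval_two (s := s))
  -- The root 2 supplies the divisor X - 2, hence the sign; the new cofactor takes at 2 the value of
  -- -P'.
  refine ⟨-R, by rw [hR, map_ofNat]; ring, ?_⟩
  have hd := h.derivative_rescaledTransform_eval_two (s := s)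
  rw [hR, derivative_mul] at hd
  simp at hd
  rw [eval_neg, hd, neg_neg]

variable {R : ℤ[X]}

theorem IsEdgeEnumeration.card_rootsNeOne (h : IsEdgeEnumeration H en x y) (hH : IsConnected H)
    (hs : ∀ i, ∀ a ∈ s i, 1 ≤ a) (hs' : ∃ i, (s i).Nonempty)
    (hR : rescaledTransform H s = (2 - X) * R) (hR2 : R.eval 2 ≠ 0) :
    (rootsNeOne H s).card = R.natDegree ∧ R.natDegree + 1 = ∑ i, (s i).sup id ∧
      |R.leadingCoeff| = emptyFibreMinor H s := by
  obtain ⟨h1, k, h2⟩ := h.coeff_rescaledTransform hs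
  have hη := h.emptyFibreMinor_pos hH hs'
  have hdeg : (rescaledTransform H s).natDegree = ∑ i, (s i).sup id := by
    refine le_antisymm h1 (le_natDegree_of_ne_zero ?_)
    rw [h2]
    exact mul_ne_zero (pow_ne_zero _ (by norm_num)) hη.ne'
  have hR0 : R ≠ 0 := fun h0 => hR2 (by rw [h0, eval_zero])
  have hX : (2 - X : ℤ[X]) = -(X - Polynomial.C 2) := by rw [map_ofNat]; ring
  refine ⟨?_, ?_, ?_⟩
  · have h2X : (2 * X : ℂ[X]) = Polynomial.C 2 * X := by rw [map_ofNat]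
    rw [rootsNeOne_eq_roots hR hR2, IsAlgClosed.card_roots_eq_natDegree, natDegree_comp, h2X,
      natDegree_C_mul_X _ (by norm_num), mul_one,
      natDegree_map_eq_of_injective (RingHom.injective_int _)]
  · rw [← hdeg, hR, hX, natDegree_mul (neg_ne_zero.mpr (X_sub_C_ne_zero 2)) hR0, natDegree_neg,
      natDegree_X_sub_C, add_comm]
  · have h3 : (rescaledTransform H s).leadingCoeff = (-1) ^ k * emptyFibreMinor H s := by
      rw [leadingCoeff, hdeg, h2]
    rw [hR, hX, leadingCoeff_mul, leadingCoeff_neg, leadingCoeff_X_sub_C] at h3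
    have h4 := congrArg abs h3
    rwa [abs_mul, abs_mul, abs_pow, abs_neg, abs_one, one_pow, one_mul, one_mul,
      abs_of_pos hη] at h4

variable [Nonempty α]

theorem IsEdgeEnumeration.numSpanningTrees_foliation_eq [NeZero n]
    (h : IsEdgeEnumeration H en x y) (hR : rescaledTransform H s = (2 - X) * R) :
    (numSpanningTrees (CirculantFoliation.foliation n H s) : ℂ) = n * numSpanningTrees H *
      ∏ j ∈ Finset.univ.erase (0 : ZMod n),
        aeval (ZMod.stdAddChar j + ZMod.stdAddChar (-j) : ℂ) R := by
  have h1 := h.numSpanningTrees_foliation (n := n) (s := s)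
  simp only [← h.aeval_rescaledTransform, hR, map_mul, map_sub, map_ofNat, aeval_X,
    Finset.prod_mul_distrib, prod_erase_zero_two_sub] at h1
  apply mul_left_cancel₀ (Nat.cast_ne_zero.mpr (NeZero.ne n) : (n : ℂ) ≠ 0)
  linear_combination h1

/-- The quotient is rational and a product of algebraic integers R(t_j), hence an integer. -/
theorem IsEdgeEnumeration.dvd_numSpanningTrees_foliation [NeZero n]
    (h : IsEdgeEnumeration H en x y) (hH : IsConnected H) :
    n * numSpanningTrees H ∣ numSpanningTrees (CirculantFoliation.foliation n H s) := by
  obtain ⟨R, hR, -⟩ := h.exists_rescaledTransform_eq_mul (s := s)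
  have h1 := h.numSpanningTrees_foliation_eq (n := n) hR
  set Z := ∏ j ∈ Finset.univ.erase (0 : ZMod n),
    aeval (ZMod.stdAddChar j + ZMod.stdAddChar (-j) : ℂ) R with hZ
  have hint : IsIntegral ℤ Z := IsIntegral.prod _ fun j _ => isIntegral_aeval_stdAddChar R j
  have h0 : ((n * numSpanningTrees H : ℕ) : ℚ) ≠ 0 := Nat.cast_ne_zero.mpr
    (mul_ne_zero (NeZero.ne n) (h.numSpanningTrees_ne_zero hH))
  have hq : algebraMap ℚ ℂ ((numSpanningTrees (CirculantFoliation.foliation n H s) : ℚ) /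
      (n * numSpanningTrees H : ℕ)) = Z := by
    have h0' : ((n * numSpanningTrees H : ℕ) : ℂ) ≠ 0 := by exact_mod_cast h0
    rw [map_div₀, map_natCast, map_natCast, h1, Nat.cast_mul]
    push_cast at h0'
    exact mul_div_cancel_left₀ _ h0'
  rw [← hq, isIntegral_algebraMap_iff (algebraMap ℚ ℂ).injective,
    IsIntegrallyClosed.isIntegral_iff] at hint
  obtain ⟨m, hm⟩ := hint
  rw [eq_div_iff h0] at hm
  refine Int.natCast_dvd_natCast.mp ⟨m, ?_⟩
  rw [mul_comm]
  rw [eq_intCast] at hm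
  exact_mod_cast hm.symm

theorem IsEdgeEnumeration.numSpanningTrees_foliation_eq_prod [NeZero n]
    (h : IsEdgeEnumeration H en x y) (hH : IsConnected H)
    (hs : ∀ i, ∀ a ∈ s i, 1 ≤ a) (hs' : ∃ i, (s i).Nonempty) :
    (rootsNeOne H s).card + 1 = ∑ i, (s i).sup id ∧
      (numSpanningTrees (CirculantFoliation.foliation n H s) : ℝ) =
        (n : ℝ) * (emptyFibreMinor H s : ℝ) ^ n / (∑ i, ∑ a ∈ s i, (a : ℝ) ^ 2) *
          ((rootsNeOne H s).map fun w : ℂ =>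
            ‖2 * (Chebyshev.T ℂ (n : ℤ)).eval w - 2‖).prod := by
  obtain ⟨R, hR, hR2⟩ := h.exists_rescaledTransform_eq_mul (s := s)
  have hτ := h.numSpanningTrees_ne_zero hH
  have hq : 0 < ∑ i, ∑ a ∈ s i, (a : ℤ) ^ 2 := by
    obtain ⟨i, a, ha⟩ := hs'
    have hnonneg : ∀ i, 0 ≤ ∑ a ∈ s i, (a : ℤ) ^ 2 := fun i =>
      Finset.sum_nonneg fun a _ => sq_nonneg _
    refine lt_of_lt_of_le ?_ (Finset.single_le_sum (fun i _ => hnonneg i) (Finset.mem_univ i))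
    refine lt_of_lt_of_le ?_ (Finset.single_le_sum (f := fun a : ℕ => (a : ℤ) ^ 2)
      (fun a _ => sq_nonneg (a : ℤ)) ha)
    have : (0 : ℤ) < a := by exact_mod_cast hs i a ha
    positivity
  have hR0 : R.eval 2 ≠ 0 := by
    rw [hR2]
    exact mul_ne_zero hq.ne' (Nat.cast_ne_zero.mpr hτ)
  obtain ⟨hc, hd, hl⟩ := h.card_rootsNeOne hH hs hs' hR hR0
  refine ⟨by rw [hc, hd], ?_⟩
  have h1 := h.numSpanningTrees_foliation_eq (n := n) hR
  have h2 : ∏ j : ZMod n, aeval (ZMod.stdAddChar j + ZMod.stdAddChar (-j) : ℂ) R =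
      (R.leadingCoeff : ℂ) ^ n * ((rootsNeOne H s).map fun w => ∏ j : ZMod n,
        ((ZMod.stdAddChar j + ZMod.stdAddChar (-j) : ℂ) - 2 * w)).prod := by
    rw [Multiset.prod_map_prod, Finset.prod_congr rfl fun j _ =>
      aeval_eq_prod_rootsNeOne hR hR0 _, Finset.prod_mul_distrib, Finset.prod_const,
      Finset.card_univ, ZMod.card]
  -- The factor at j = 0 is R(2) = q τ(H); including it completes the product and brings in q.
  have h3 : aeval (ZMod.stdAddChar (0 : ZMod n) + ZMod.stdAddChar (-0 : ZMod n) : ℂ) R =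
      ((∑ i, ∑ a ∈ s i, (a : ℤ) ^ 2 : ℤ) : ℂ) * numSpanningTrees H := by
    rw [neg_zero, AddChar.map_zero_eq_one, one_add_one_eq_two, aeval_def, ← eval_map,
      algebraMap_int_eq, ← map_ofNat (Int.castRingHom ℂ) 2, eval_map_apply, hR2]
    simp
  rw [← Finset.mul_prod_erase _ _ (Finset.mem_univ 0), h3] at h2
  have h4 : ((∑ i, ∑ a ∈ s i, (a : ℤ) ^ 2 : ℤ) : ℂ) *
      numSpanningTrees (CirculantFoliation.foliation n H s) = n * ((R.leadingCoeff : ℂ) ^ n *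
      ((rootsNeOne H s).map fun w => ∏ j : ZMod n,
        ((ZMod.stdAddChar j + ZMod.stdAddChar (-j) : ℂ) - 2 * w)).prod) := by
    rw [h1, ← h2]; ring
  -- The leading coefficient and the factors are known only up to sign, so norms are compared.
  have h5 := congrArg norm h4
  have h6 : ∀ w : ℂ, ‖∏ j : ZMod n, ((ZMod.stdAddChar j + ZMod.stdAddChar (-j) : ℂ) - 2 * w)‖ =
      ‖2 * (Chebyshev.T ℂ (n : ℤ)).eval w - 2‖ := by
    intro w
    rw [← prod_two_mul_sub, norm_prod, norm_prod]
    exact Finset.prod_congr rfl fun j _ => norm_sub_rev _ _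
  have h7 : ∀ m : Multiset ℂ, ‖(m.map fun w => ∏ j : ZMod n,
      ((ZMod.stdAddChar j + ZMod.stdAddChar (-j) : ℂ) - 2 * w)).prod‖ =
      (m.map fun w : ℂ => ‖2 * (Chebyshev.T ℂ (n : ℤ)).eval w - 2‖).prod := by
    intro m
    induction m using Multiset.induction_on with
    | empty => simp
    | cons w m ih => rw [Multiset.map_cons, Multiset.map_cons, Multiset.prod_cons,
        Multiset.prod_cons, norm_mul, ih, h6]
  have hqR : (0 : ℝ) < ∑ i, ∑ a ∈ s i, (a : ℝ) ^ 2 := by exact_mod_cast hq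
  have h8 : ‖((∑ i, ∑ a ∈ s i, (a : ℤ) ^ 2 : ℤ) : ℂ)‖ = ∑ i, ∑ a ∈ s i, (a : ℝ) ^ 2 := by
    rw [Complex.norm_intCast, abs_of_pos (by exact_mod_cast hq)]
    push_cast
    rfl
  rw [norm_mul, norm_mul, norm_mul, norm_pow, h7, h8, Complex.norm_natCast, Complex.norm_natCast,
    Complex.norm_intCast, ← Int.cast_abs, hl] at h5
  rw [div_mul_eq_mul_div, eq_div_iff hqR.ne']
  linear_combination h5

end Formula

end CirculantFoliation

theorem theorem1 {α β : Type*} [Fintype α] [DecidableEq α]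
    -- `H`: a finite connected loopless multigraph with vertex set `α`
    (H : Graph α β) (hV : H.vertexSet = Set.univ) (hE : H.edgeSet.Finite) (hloop : H.Loopless)
    (hconn : CirculantFoliation.IsConnected H)
    -- `n` and the sets of jumps `s i = {s_{i,1} < … < s_{i,k_i}}`, contained in `[1, n / 2]`
    (n : ℕ) (hn : 1 ≤ n) (s : α → Finset ℕ) (hs : ∀ i, ∀ a ∈ s i, 1 ≤ a ∧ 2 * a ≤ n) :
    -- all fibres non-empty: exactly `s - 1` roots `w_p ≠ 1`, and the closed formula
    ((∀ i, (s i).Nonempty) →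
      (CirculantFoliation.rootsNeOne H s).card + 1 = ∑ i, (s i).sup id ∧
      (CirculantFoliation.numSpanningTrees (CirculantFoliation.foliation n H s) : ℝ) =
        (n : ℝ) / (∑ i, ∑ a ∈ s i, (a : ℝ) ^ 2) *
          ((CirculantFoliation.rootsNeOne H s).map fun w : ℂ =>
            ‖2 * (Polynomial.Chebyshev.T ℂ (n : ℤ)).eval w - 2‖).prod) ∧
    -- some, but not all, fibres may be empty
    ((∃ i, (s i).Nonempty) →
      (CirculantFoliation.rootsNeOne H s).card + 1 = ∑ i, (s i).sup id ∧
      (CirculantFoliation.numSpanningTrees (CirculantFoliation.foliation n H s) : ℝ) =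
        (n : ℝ) * (CirculantFoliation.emptyFibreMinor H s : ℝ) ^ n /
            (∑ i, ∑ a ∈ s i, (a : ℝ) ^ 2) *
          ((CirculantFoliation.rootsNeOne H s).map fun w : ℂ =>
            ‖2 * (Polynomial.Chebyshev.T ℂ (n : ℤ)).eval w - 2‖).prod) ∧
    -- the number of spanning trees is a multiple of `n τ(H)`
    n * CirculantFoliation.numSpanningTrees H ∣
      CirculantFoliation.numSpanningTrees (CirculantFoliation.foliation n H s) := by
  have : NeZero n := ⟨by omega⟩
  obtain ⟨i₀, -⟩ := hconn.1
  have : Nonempty α := ⟨i₀⟩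
  have : Fintype H.edgeSet := hE.fintype
  have hends : ∀ e : H.edgeSet, ∃ p : α × α, H.IsLink e p.1 p.2 := fun e =>
    let ⟨x, y, h⟩ := Graph.exists_isLink_of_mem_edgeSet e.2
    ⟨(x, y), h⟩
  choose ends hends using hends
  have h : CirculantFoliation.IsEdgeEnumeration H (Subtype.val : H.edgeSet → β) (fun e => (ends e).1)
      (fun e => (ends e).2) := ⟨hV, Subtype.val_injective, fun e he => ⟨⟨e, he⟩, rfl⟩, hends⟩
  have hs1 : ∀ i, ∀ a ∈ s i, 1 ≤ a := fun i a ha => (hs i a ha).1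
  refine ⟨fun hs' => ?_, fun hs' => h.numSpanningTrees_foliation_eq_prod hconn hs1 hs',
    h.dvd_numSpanningTrees_foliation hconn⟩
  have hη : CirculantFoliation.emptyFibreMinor H s = 1 := by
    have : IsEmpty {i // s i = ∅} := ⟨fun i => (hs' i.1).ne_empty i.2⟩
    exact Matrix.det_isEmpty
  simpa [hη] using h.numSpanningTrees_foliation_eq_prod (n := n) hconn hs1 ⟨i₀, hs' i₀⟩
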